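/- Let $M$ be a nonempty closed smooth manifold (compact, Hausdorff, without boundary) of dimension $n$. For a smooth Riemannian metric $g$ on $M$ with Riemann curvature tensor $R$ (with the sign convention for which $R(e_i,e_j,e_i,e_j)$ is the sectional curvature for orthonormal $e_i,e_j$) and scalar curvature $\mathrm{Scal}$, and for $t\in\mathbb R$, put $$\mathrm{Riem}_t(g):=\mathrm{Scal}\,\frac{g^2}{2}-2t\,R ,$$ where $g^2$ is the Kulkarni--Nomizu square of $g$. Write $\mathrm{Riem}_t(g)>0$ if at every point of $M$ this tensor is positive definite as a quadratic form on bivectors (elements of $\Lambda^2T_pM$). If $g$ has positive scalar curvature at every point, define $$\mathrm{Riem}(g):=\sup\{t\in(0,\tfrac{n(n-1)}2):\ \mathrm{Riem}_t(g)>0\}$$ (with $\sup\emptyset=0$), and otherwise set $\mathrm{Riem}(g):=0$. Let $$\mathbf{Riem}(M):=\sup\{\mathrm{Riem}(g):\ g \text{ a smooth Riemannian metric on } M\}.$$ **Proposition (ideal property).** Let $M_1$ and $M_2$ be nonempty closed smooth manifolds. Then $$\mathbf{Riem}(M_1\times M_2)\ \ge\ \max\{\mathbf{Riem}(M_1),\mathbf{Riem}(M_2)\}.$$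 -/

import Mathlib

open scoped Manifold ContDiff

noncomputable section

namespace RiemInv

/-! ### Local Riemannian geometry

`G y` is the matrix of a Riemannian metric at the point `y` of a (finite-dimensional) vector
space `E`, i.e. the metric written in a coordinate chart with values in `E`. -/

section Local

variable {E : Type*} [NormedAddCommGroup E] [NormedSpace ℝ E]

set_option maxSynthPendingDepth 5 in
/-- Christoffel symbols of the first kind:
`(u, v, w) ↦ (∂_u G(v, w) + ∂_v G(u, w) - ∂_w G(u, v)) / 2`. -/
def christoffelLower (G : E → E →L[ℝ] E →L[ℝ] ℝ) (y : E) : E →L[ℝ] E →L[ℝ] E →L[ℝ] ℝ :=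
  (1 / 2 : ℝ) • (fderiv ℝ G y + (fderiv ℝ G y).flip -
    ((ContinuousLinearMap.flipₗᵢ ℝ E E ℝ).toContinuousLinearEquiv :
      (E →L[ℝ] E →L[ℝ] ℝ) →L[ℝ] (E →L[ℝ] E →L[ℝ] ℝ)).comp (fderiv ℝ G y).flip)

set_option maxSynthPendingDepth 5 in
theorem christoffelLower_apply (G : E → E →L[ℝ] E →L[ℝ] ℝ) (y u v w : E) :
    christoffelLower G y u v w =
      (1 / 2 : ℝ) * (fderiv ℝ G y u v w + fderiv ℝ G y v u w - fderiv ℝ G y w u v) := by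
  simp [christoffelLower]

/-- Christoffel symbols of the second kind: `christoffel G y u v` is the vector `Γ(u, v)` with
`G(Γ(u, v), w) = christoffelLower G y u v w` for all `w`. -/
def christoffel (G : E → E →L[ℝ] E →L[ℝ] ℝ) (y : E) : E →L[ℝ] E →L[ℝ] E :=
  (ContinuousLinearMap.compL ℝ E (E →L[ℝ] ℝ) E (G y).inverse).comp (christoffelLower G y)

theorem christoffel_apply (G : E → E →L[ℝ] E →L[ℝ] ℝ) (y u v : E) :
    christoffel G y u v = (G y).inverse (christoffelLower G y u v) := by
  simp [christoffel]

/-- The Riemann curvature endomorphism `R(u, v) = [∇_u, ∇_v] - ∇_[u, v]` of the Levi-Civita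
connection of `G`, written in coordinates. -/
def curvature (G : E → E →L[ℝ] E →L[ℝ] ℝ) (y u v : E) : E →L[ℝ] E :=
  fderiv ℝ (christoffel G) y u v - fderiv ℝ (christoffel G) y v u
    + (christoffel G y u).comp (christoffel G y v)
    - (christoffel G y v).comp (christoffel G y u)

/-- The Riemann curvature tensor as a `(0, 4)`-tensor, with the sign for which
`curvature4 G y u v u v` is the sectional curvature when `u, v` are orthonormal. -/
def curvature4 (G : E → E →L[ℝ] E →L[ℝ] ℝ) (y u v w z : E) : ℝ :=
  G y (curvature G y u v z) w

/-- The endomorphism `u ↦ R(u, v) w`. -/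
def ricciEnd (G : E → E →L[ℝ] E →L[ℝ] ℝ) (y v w : E) : E →ₗ[ℝ] E where
  toFun u := curvature G y u v w
  map_add' a b := by simp [curvature]; abel
  map_smul' c a := by simp [curvature, smul_sub, smul_add]

/-- The Ricci tensor `Ric(v, w) = tr (u ↦ R(u, v) w)`. -/
def ricci (G : E → E →L[ℝ] E →L[ℝ] ℝ) (y : E) : E →ₗ[ℝ] E →ₗ[ℝ] ℝ :=
  LinearMap.mk₂ ℝ (fun v w => LinearMap.trace ℝ E (ricciEnd G y v w))
    (fun a b w => by
      rw [← map_add]; congr 1; ext u; simp [ricciEnd, curvature]; abel)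
    (fun c a w => by
      rw [← map_smul]; congr 1; ext u; simp [ricciEnd, curvature, smul_sub, smul_add])
    (fun v a b => by
      rw [← map_add]; congr 1; ext u; simp [ricciEnd])
    (fun c v a => by
      rw [← map_smul]; congr 1; ext u; simp [ricciEnd])

variable [FiniteDimensional ℝ E]

/-- The scalar curvature: the trace of the Ricci tensor with respect to `G`, i.e. the trace of the
endomorphism `v ↦ Ric(v, ·)^♯`. -/
def scal (G : E → E →L[ℝ] E →L[ℝ] ℝ) (y : E) : ℝ :=
  LinearMap.trace ℝ E
    ((G y).inverse.toLinearMap ∘ₗ (LinearMap.toContinuousLinearMap.toLinearMap ∘ₗ ricci G y))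

/-- The Kulkarni-Nomizu product of two symmetric bilinear forms. -/
def kulkarniNomizu (h k : E →L[ℝ] E →L[ℝ] ℝ) (u v w z : E) : ℝ :=
  h u w * k v z + h v z * k u w - h u z * k v w - h v w * k u z

/-- The curvature tensor `Riem_t = Scal * g² / 2 - 2 t R`, where `g²` is the Kulkarni-Nomizu square
of the metric. -/
def riemTensor (G : E → E →L[ℝ] E →L[ℝ] ℝ) (y : E) (t : ℝ) (u v w z : E) : ℝ :=
  scal G y * (kulkarniNomizu (G y) (G y) u v w z / 2) - 2 * t * curvature4 G y u v w z

/-- Positive definiteness of a curvature-like tensor `T`, seen as a quadratic form on bivectors: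
`T(ω, ω) > 0` for every nonzero `ω = ∑ a, x a ∧ y a` in the exterior square of `E`. -/
def PosDefOnBivectors (T : E → E → E → E → ℝ) : Prop :=
  ∀ (k : ℕ) (x y : Fin k → E),
    ∑ a, exteriorPower.ιMulti ℝ 2 ![x a, y a] ≠ 0 →
      0 < ∑ a, ∑ b, T (x a) (y a) (x b) (y b)

end Local

/-! ### Riemannian metrics on manifolds without boundary -/

section Manifold

variable {E : Type*} [NormedAddCommGroup E] [NormedSpace ℝ E]
  {H : Type*} [TopologicalSpace H] (I : ModelWithCorners ℝ E H)
  (M : Type*) [TopologicalSpace M] [ChartedSpace H M] [IsManifold I ∞ M]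

/-- The smooth Riemannian metrics on `M`. -/
abbrev Metric : Type _ :=
  Bundle.ContMDiffRiemannianMetric I ∞ E (fun x : M => TangentSpace I x)

variable {I M}

/-- The metric `g` in the preferred chart at `p`: the pullback of `g` by the inverse chart. -/
def metricInChart (g : Metric I M) (p : M) (y : E) : E →L[ℝ] E →L[ℝ] ℝ :=
  let A : E →L[ℝ] E := mfderiv 𝓘(ℝ, E) I (extChartAt I p).symm y
  let B : E →L[ℝ] E →L[ℝ] ℝ := g.inner ((extChartAt I p).symm y)
  B.bilinearComp A A

theorem metricInChart_apply (g : Metric I M) (p : M) (y u v : E) :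
    metricInChart g p y u v = g.inner ((extChartAt I p).symm y)
      (mfderiv 𝓘(ℝ, E) I (extChartAt I p).symm y u)
      (mfderiv 𝓘(ℝ, E) I (extChartAt I p).symm y v) := rfl

variable [FiniteDimensional ℝ E]

/-- The scalar curvature of `g` at `p`. -/
def scalAt (g : Metric I M) (p : M) : ℝ :=
  scal (metricInChart g p) (extChartAt I p p)

/-- The tensor `Riem_t(g)` at `p`, in the chart at `p`. -/
def riemTensorAt (g : Metric I M) (t : ℝ) (p : M) : E → E → E → E → ℝ :=
  riemTensor (metricInChart g p) (extChartAt I p p) t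

/-- `Riem_t(g) > 0`: positive definite at each point of `M`. -/
def RiemTensorPos (g : Metric I M) (t : ℝ) : Prop :=
  ∀ p : M, PosDefOnBivectors (riemTensorAt g t p)

open Classical in
/-- The metric invariant `Riem(g) = sup {t ∈ (0, n(n-1)/2) : Riem_t(g) > 0}`, set to be `0` if the
scalar curvature of `g` is not positive; `n` is the dimension of `M`. -/
def riemMetric (g : Metric I M) : ℝ :=
  if ∀ p : M, 0 < scalAt g p then
    sSup {t : ℝ | 0 < t ∧
      t < (Module.finrank ℝ E : ℝ) * ((Module.finrank ℝ E : ℝ) - 1) / 2 ∧ RiemTensorPos g t}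
  else 0

theorem riemMetric_nonneg (g : Metric I M) : 0 ≤ riemMetric g := by
  unfold riemMetric
  split_ifs
  · exact Real.sSup_nonneg fun t ht => ht.1.le
  · exact le_rfl

theorem riemMetric_le (g : Metric I M) :
    riemMetric g ≤ (Module.finrank ℝ E : ℝ) * ((Module.finrank ℝ E : ℝ) - 1) / 2 := by
  have h0 : 0 ≤ (Module.finrank ℝ E : ℝ) * ((Module.finrank ℝ E : ℝ) - 1) / 2 := by
    rcases Nat.eq_zero_or_pos (Module.finrank ℝ E) with h | h
    · simp [h]
    · have : (1 : ℝ) ≤ Module.finrank ℝ E := by exact_mod_cast h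
      have := mul_nonneg (by linarith : (0 : ℝ) ≤ Module.finrank ℝ E) (sub_nonneg.2 this)
      linarith
  unfold riemMetric
  split_ifs
  · exact Real.sSup_le (fun t ht => ht.2.1.le) h0
  · exact h0

variable (I M)

/-- The smooth invariant `Riem(M)`: the supremum of `Riem(g)` over all Riemannian metrics `g`
on `M`. -/
def riemManifold : ℝ := sSup (Set.range fun g : Metric I M => riemMetric g)

/-- The supremum that defines `Riem(M)` is over a bounded set. -/
theorem bddAbove_riemMetric : BddAbove (Set.range fun g : Metric I M => riemMetric g) :=
  ⟨_, by rintro _ ⟨g, rfl⟩; exact riemMetric_le g⟩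

end Manifold

end RiemInv

end

/-!
Write `s₁`, `s₂` for the scalar curvatures of `g₁`, `g₂`. Along
`Λ²(E₁ × E₂) = Λ²E₁ ⊕ (E₁ ⊗ E₂) ⊕ Λ²E₂` the tensor `Riem_t` of the product metric is block diagonal,
with blocks `s₂ g₁² / 2 + Riem_t(g₁)`, a positive multiple of `s₁ + s₂`, and
`s₁ g₂² / 2 + Riem_t(g₂)`.

If `s₁ > 0` and `Riem_t(g₁) > 0`, take an arbitrary metric `g` on the second factor and put
`g₂ = δ⁻¹ g`. Up to positive factors the blocks depend continuously on `δ`, and at `δ = 0` they are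
`Riem_t(g₁)`, `s₁` and `s₁ g² / 2`, which are all positive. Positivity is an open condition, so by
compactness of `M₁ × M₂` it holds for small `δ > 0`. As `n(n-1)/2` grows with the dimension, this
`t` is admissible for the product as well.
-/

noncomputable section

namespace RiemInv

open Filter Topology

section LocalGeometry

variable {E : Type*} [NormedAddCommGroup E] [NormedSpace ℝ E]
  {G G' : E → E →L[ℝ] E →L[ℝ] ℝ} {y : E}

theorem christoffelLower_congr (hG : G' =ᶠ[𝓝 y] G) :
    christoffelLower G' y = christoffelLower G y := by
  simp only [christoffelLower, hG.fderiv_eq]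

theorem christoffel_congr (hG : G' =ᶠ[𝓝 y] G) : christoffel G' =ᶠ[𝓝 y] christoffel G := by
  filter_upwards [hG.eventuallyEq_nhds] with z hz
  simp only [christoffel, christoffelLower_congr hz, hz.self_of_nhds]

theorem curvature_congr (hG : G' =ᶠ[𝓝 y] G) : curvature G' y = curvature G y := by
  ext u v
  simp only [curvature, (christoffel_congr hG).fderiv_eq, (christoffel_congr hG).self_of_nhds]

theorem curvature4_congr (hG : G' =ᶠ[𝓝 y] G) : curvature4 G' y = curvature4 G y := by
  ext u v w z
  simp only [curvature4, curvature_congr hG, hG.self_of_nhds]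

theorem ricci_congr (hG : G' =ᶠ[𝓝 y] G) : ricci G' y = ricci G y := by
  ext u v
  simp only [ricci, ricciEnd, curvature_congr hG]

theorem scal_congr [FiniteDimensional ℝ E] (hG : G' =ᶠ[𝓝 y] G) : scal G' y = scal G y := by
  simp only [scal, ricci_congr hG, hG.self_of_nhds]

theorem riemTensor_congr [FiniteDimensional ℝ E] (hG : G' =ᶠ[𝓝 y] G) :
    riemTensor G' y = riemTensor G y := by
  ext t u v w z
  simp only [riemTensor, scal_congr hG, hG.eq_of_nhds, curvature4_congr hG]

theorem curvature_apply (G : E → E →L[ℝ] E →L[ℝ] ℝ) (y u v z : E) :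
    curvature G y u v z = fderiv ℝ (christoffel G) y u v z - fderiv ℝ (christoffel G) y v u z
      + christoffel G y u (christoffel G y v z) - christoffel G y v (christoffel G y u z) := by
  simp [curvature]

theorem curvature_antisymm (G : E → E →L[ℝ] E →L[ℝ] ℝ) (y u v : E) :
    curvature G y u v = - curvature G y v u := by
  simp only [curvature]
  abel

theorem ricci_apply (G : E → E →L[ℝ] E →L[ℝ] ℝ) (y v w : E) :
    ricci G y v w = LinearMap.trace ℝ E (ricciEnd G y v w) := rfl

theorem hasFDerivAt_apply₂ {F : Type*} [NormedAddCommGroup F] [NormedSpace ℝ F]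
    {f : E → E →L[ℝ] E →L[ℝ] F} (hf : DifferentiableAt ℝ f y) (v w : E) :
    HasFDerivAt (fun z => f z v w) (((fderiv ℝ f y).flip v).flip w) y := by
  simpa using (hf.hasFDerivAt.clm_apply (hasFDerivAt_const v y)).clm_apply (hasFDerivAt_const w y)

theorem fderiv_apply₂ (hG : DifferentiableAt ℝ G y) (u v w : E) :
    fderiv ℝ G y u v w = fderiv ℝ (fun z => G z v w) y u := by
  rw [(hasFDerivAt_apply₂ hG v w).fderiv]
  rfl

/-- `G` is a smooth Riemannian metric in a neighbourhood of `y`. -/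
structure MetricNear (G : E → E →L[ℝ] E →L[ℝ] ℝ) (y : E) : Prop where
  contDiffAt : ∀ᶠ z in 𝓝 y, ContDiffAt ℝ ∞ G z
  symm : ∀ᶠ z in 𝓝 y, ∀ u v, G z u v = G z v u
  pos : ∀ᶠ z in 𝓝 y, ∀ v, v ≠ 0 → 0 < G z v v

theorem isInvertible_of_pos [FiniteDimensional ℝ E] {B : E →L[ℝ] E →L[ℝ] ℝ}
    (hB : ∀ v, v ≠ 0 → 0 < B v v) : B.IsInvertible := by
  have hinj : Function.Injective B.toLinearMap := by
    refine (injective_iff_map_eq_zero _).2 fun v hv => by_contra fun hne => (hB v hne).ne' ?_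
    exact DFunLike.congr_fun hv v
  have hdim : Module.finrank ℝ E = Module.finrank ℝ (E →L[ℝ] ℝ) := by
    rw [← (LinearMap.toContinuousLinearMap (𝕜 := ℝ) (E := E) (F' := ℝ)).finrank_eq]
    exact Subspace.dual_finrank_eq.symm
  exact ⟨(LinearEquiv.ofInjectiveOfFinrankEq B.toLinearMap hinj hdim).toContinuousLinearEquiv, rfl⟩

namespace MetricNear

theorem eventually (h : MetricNear G y) : ∀ᶠ z in 𝓝 y, MetricNear G z := by
  filter_upwards [h.contDiffAt.eventually_nhds, h.symm.eventually_nhds, h.pos.eventually_nhds]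
    with z hsmooth hsymm hpos using ⟨hsmooth, hsymm, hpos⟩

theorem apply_comm (h : MetricNear G y) (u v : E) : G y u v = G y v u :=
  h.symm.self_of_nhds u v

theorem continuousAt (h : MetricNear G y) : ContinuousAt G y :=
  h.contDiffAt.self_of_nhds.continuousAt

theorem differentiableAt (h : MetricNear G y) : DifferentiableAt ℝ G y :=
  h.contDiffAt.self_of_nhds.differentiableAt (by simp)

theorem contDiffAt_apply_self (h : MetricNear G y) (z : E) :
    ContDiffAt ℝ ∞ (fun x => G x z z) y :=
  (h.contDiffAt.self_of_nhds.clm_apply contDiffAt_const).clm_apply contDiffAt_const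

theorem fderiv_symm (h : MetricNear G y) (u v w : E) :
    fderiv ℝ G y u v w = fderiv ℝ G y u w v := by
  have hsymm : (fun z => G z v w) =ᶠ[𝓝 y] fun z => G z w v := by
    filter_upwards [h.symm] with z hz using hz v w
  rw [fderiv_apply₂ h.differentiableAt, fderiv_apply₂ h.differentiableAt, hsymm.fderiv_eq]

variable [FiniteDimensional ℝ E]

theorem isInvertible (h : MetricNear G y) : (G y).IsInvertible :=
  isInvertible_of_pos h.pos.self_of_nhds

theorem ext (h : MetricNear G y) {u v : E} (huv : ∀ w, G y u w = G y v w) : u = v :=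
  h.isInvertible.injective (ContinuousLinearMap.ext huv)

theorem christoffel_spec (h : MetricNear G y) (u v w : E) :
    G y (christoffel G y u v) w = christoffelLower G y u v w := by
  rw [christoffel_apply, h.isInvertible.self_apply_inverse]

theorem fderiv_eq_christoffel (h : MetricNear G y) (u v w : E) :
    fderiv ℝ G y u v w = G y (christoffel G y u v) w + G y v (christoffel G y u w) := by
  rw [h.apply_comm v, h.christoffel_spec, h.christoffel_spec, christoffelLower_apply,
    christoffelLower_apply, h.fderiv_symm u w v]
  ring

set_option maxSynthPendingDepth 5 in
theorem contDiffAt_christoffel (h : MetricNear G y) : ContDiffAt ℝ ∞ (christoffel G) y := by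
  have hG : ContDiffAt ℝ ∞ G y := h.contDiffAt.self_of_nhds
  have hdG : ContDiffAt ℝ ∞ (fderiv ℝ G) y := hG.fderiv_right (by simp)
  have hflip : ContDiffAt ℝ ∞ (fun z => (fderiv ℝ G z).flip) y :=
    (ContinuousLinearMap.flipₗᵢ ℝ E E (E →L[ℝ] ℝ)).contDiff.contDiffAt.comp y hdG
  have hlower : ContDiffAt ℝ ∞ (christoffelLower G) y :=
    ((hdG.add hflip).sub (contDiffAt_const.clm_comp hflip)).const_smul (1 / 2 : ℝ)
  have hinverse : ContDiffAt ℝ ∞ (fun z => (G z).inverse) y := by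
    obtain ⟨e, he⟩ := h.isInvertible
    exact ContDiffAt.comp y (he ▸ contDiffAt_map_inverse (𝕜 := ℝ) (n := ∞) e) hG
  exact ((ContinuousLinearMap.compL ℝ E (E →L[ℝ] ℝ) E).contDiff.contDiffAt.comp y
    hinverse).clm_comp hlower

theorem differentiableAt_christoffel (h : MetricNear G y) :
    DifferentiableAt ℝ (christoffel G) y :=
  h.contDiffAt_christoffel.differentiableAt (by simp)

theorem fderiv_apply_self (h : MetricNear G y) (u z : E) :
    fderiv ℝ (fun x => G x z z) y u = 2 * G y (christoffel G y u z) z := by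
  rw [← fderiv_apply₂ h.differentiableAt, h.fderiv_eq_christoffel, h.apply_comm z]
  ring

theorem fderiv_fderiv_apply_self (h : MetricNear G y) (u v z : E) :
    fderiv ℝ (fderiv ℝ (fun x => G x z z)) y v u =
      2 * (G y (christoffel G y v (christoffel G y u z)) z
        + G y (christoffel G y u z) (christoffel G y v z)
        + G y (fderiv ℝ (christoffel G) y v u z) z) := by
  have hdiff : DifferentiableAt ℝ (fderiv ℝ (fun x => G x z z)) y :=
    ((h.contDiffAt_apply_self z).fderiv_right (m := ∞) (by simp)).differentiableAt (by simp)
  have hfirst : (fun x => fderiv ℝ (fun x => G x z z) x u) =ᶠ[𝓝 y]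
      fun x => 2 * G x (christoffel G x u z) z := by
    filter_upwards [h.eventually] with x hx using hx.fderiv_apply_self u z
  have hsecond := (hdiff.hasFDerivAt.clm_apply (hasFDerivAt_const u y)).congr_of_eventuallyEq
    hfirst.symm
  have hΓ := hasFDerivAt_apply₂ h.differentiableAt_christoffel u z
  have hright := ((h.differentiableAt.hasFDerivAt.clm_apply hΓ).clm_apply
    (hasFDerivAt_const z y)).const_mul 2
  have hv := DFunLike.congr_fun (hsecond.unique hright) v
  simp only [smul_apply, add_apply, ContinuousLinearMap.flip_apply,
    ContinuousLinearMap.comp_apply, zero_apply, map_zero, smul_eq_mul, zero_add,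
    h.fderiv_eq_christoffel] at hv
  rw [hv]
  ring

-- This amounts to the symmetry of the Hessian of `x ↦ G x z z`.
theorem curvature4_self (h : MetricNear G y) (u v z : E) : curvature4 G y u v z z = 0 := by
  have hsymm := ((h.contDiffAt_apply_self z).isSymmSndFDerivAt
    (by simpa using ENat.LEInfty.out)).eq u v
  rw [h.fderiv_fderiv_apply_self, h.fderiv_fderiv_apply_self,
    h.apply_comm (christoffel G y u z)] at hsymm
  simp only [curvature4, curvature_apply, map_add, map_sub, add_apply, sub_apply]
  linarith

theorem curvature4_antisymm (h : MetricNear G y) (u v w z : E) :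
    curvature4 G y u v w z = - curvature4 G y u v z w := by
  have hsum := h.curvature4_self u v (w + z)
  have hw := h.curvature4_self u v w
  have hz := h.curvature4_self u v z
  simp only [curvature4, map_add, add_apply] at hsum hw hz ⊢
  linarith

end MetricNear

variable [FiniteDimensional ℝ E]

/-- The Ricci tensor as an endomorphism: `v ↦ Ric(v, ·)^♯`. -/
def ricciSharp (G : E → E →L[ℝ] E →L[ℝ] ℝ) (y : E) : E →ₗ[ℝ] E :=
  (G y).inverse.toLinearMap ∘ₗ (LinearMap.toContinuousLinearMap.toLinearMap ∘ₗ ricci G y)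

theorem scal_eq_trace_ricciSharp (G : E → E →L[ℝ] E →L[ℝ] ℝ) (y : E) :
    scal G y = LinearMap.trace ℝ E (ricciSharp G y) := rfl

theorem MetricNear.ricciSharp_spec (h : MetricNear G y) (v w : E) :
    G y (ricciSharp G y v) w = ricci G y v w := by
  simp [ricciSharp, h.isInvertible.self_apply_inverse]

/-- The tensor `a * g² / 2 + b * Riem_t(g)`. It is needed since a product with a factor of scalar
curvature `s` replaces `Riem_t(g)` by `s * g² / 2 + Riem_t(g)`. -/
def riemPencil (G : E → E →L[ℝ] E →L[ℝ] ℝ) (y : E) (t a b : ℝ) (u v w z : E) : ℝ :=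
  a * (kulkarniNomizu (G y) (G y) u v w z / 2) + b * riemTensor G y t u v w z

end LocalGeometry

section Naturality

variable {E : Type*} [NormedAddCommGroup E] [NormedSpace ℝ E]

/-- `φ` is a smooth local isometry near `y` from the metric `G'` to the metric `G`. -/
structure IsometryNear (G' G : E → E →L[ℝ] E →L[ℝ] ℝ) (φ : E → E) (y : E) : Prop where
  source : MetricNear G' y
  target : MetricNear G (φ y)
  contDiffAt : ∀ᶠ z in 𝓝 y, ContDiffAt ℝ ∞ φ z
  pullback : ∀ᶠ z in 𝓝 y, ∀ u v, G' z u v = G (φ z) (fderiv ℝ φ z u) (fderiv ℝ φ z v)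

namespace IsometryNear

variable {G' G : E → E →L[ℝ] E →L[ℝ] ℝ} {φ : E → E} {y : E}

theorem eventually (h : IsometryNear G' G φ y) : ∀ᶠ z in 𝓝 y, IsometryNear G' G φ z := by
  filter_upwards [h.source.eventually,
    h.contDiffAt.self_of_nhds.continuousAt.eventually h.target.eventually,
    h.contDiffAt.eventually_nhds, h.pullback.eventually_nhds]
    with z hsource htarget hsmooth hpullback using ⟨hsource, htarget, hsmooth, hpullback⟩

theorem differentiableAt (h : IsometryNear G' G φ y) : DifferentiableAt ℝ φ y :=
  h.contDiffAt.self_of_nhds.differentiableAt (by simp)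

theorem contDiffAt_fderiv (h : IsometryNear G' G φ y) : ContDiffAt ℝ ∞ (fderiv ℝ φ) y :=
  h.contDiffAt.self_of_nhds.fderiv_right (by simp)

theorem hasFDerivAt_fderiv (h : IsometryNear G' G φ y) :
    HasFDerivAt (fderiv ℝ φ) (fderiv ℝ (fderiv ℝ φ) y) y :=
  (h.contDiffAt_fderiv.differentiableAt (by simp)).hasFDerivAt

theorem fderiv_fderiv_symm (h : IsometryNear G' G φ y) (u v : E) :
    fderiv ℝ (fderiv ℝ φ) y u v = fderiv ℝ (fderiv ℝ φ) y v u :=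
  (h.contDiffAt.self_of_nhds.isSymmSndFDerivAt (by simpa using ENat.LEInfty.out)).eq u v

theorem fderiv_apply (h : IsometryNear G' G φ y) (u v w : E) :
    fderiv ℝ G' y u v w = fderiv ℝ G (φ y) (fderiv ℝ φ y u) (fderiv ℝ φ y v) (fderiv ℝ φ y w)
      + G (φ y) (fderiv ℝ (fderiv ℝ φ) y u v) (fderiv ℝ φ y w)
      + G (φ y) (fderiv ℝ φ y v) (fderiv ℝ (fderiv ℝ φ) y u w) := by
  have hpullback : (fun z => G' z v w) =ᶠ[𝓝 y]
      fun z => G (φ z) (fderiv ℝ φ z v) (fderiv ℝ φ z w) := by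
    filter_upwards [h.pullback] with z hz using hz v w
  have hG := HasFDerivAt.comp (g := G) y h.target.differentiableAt.hasFDerivAt
    h.differentiableAt.hasFDerivAt
  have hright := (hG.clm_apply (h.hasFDerivAt_fderiv.clm_apply
    (hasFDerivAt_const v y))).clm_apply (h.hasFDerivAt_fderiv.clm_apply (hasFDerivAt_const w y))
  rw [fderiv_apply₂ h.source.differentiableAt, hpullback.fderiv_eq]
  refine (DFunLike.congr_fun hright.fderiv u).trans ?_
  simp only [Function.comp_apply, add_apply, ContinuousLinearMap.flip_apply,
    ContinuousLinearMap.comp_apply, zero_apply, map_zero, zero_add]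
  ring

variable [FiniteDimensional ℝ E]

theorem exists_equiv (h : IsometryNear G' G φ y) :
    ∃ e : E ≃ₗ[ℝ] E, e.toLinearMap = fderiv ℝ φ y := by
  have hinj : Function.Injective (fderiv ℝ φ y).toLinearMap := by
    refine (injective_iff_map_eq_zero _).2 fun v hv =>
      by_contra fun hne => (h.source.pos.self_of_nhds v hne).ne' ?_
    rw [h.pullback.self_of_nhds, show fderiv ℝ φ y v = 0 from hv, map_zero]
  exact ⟨LinearEquiv.ofInjectiveEndo _ hinj, rfl⟩

theorem surjective (h : IsometryNear G' G φ y) : Function.Surjective (fderiv ℝ φ y) := by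
  obtain ⟨e, he⟩ := h.exists_equiv
  exact (congrArg DFunLike.coe he) ▸ e.surjective

theorem christoffel_apply (h : IsometryNear G' G φ y) (u v : E) :
    fderiv ℝ φ y (christoffel G' y u v) =
      christoffel G (φ y) (fderiv ℝ φ y u) (fderiv ℝ φ y v) + fderiv ℝ (fderiv ℝ φ) y u v := by
  apply h.target.ext
  intro w'
  obtain ⟨w, rfl⟩ := h.surjective w'
  rw [← h.pullback.self_of_nhds, h.source.christoffel_spec, map_add, add_apply,
    h.target.christoffel_spec, christoffelLower_apply, christoffelLower_apply,
    h.fderiv_apply, h.fderiv_apply, h.fderiv_apply, h.fderiv_fderiv_symm v u,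
    h.fderiv_fderiv_symm w u, h.fderiv_fderiv_symm w v, h.target.apply_comm (fderiv ℝ φ y u),
    h.target.apply_comm (fderiv ℝ φ y v) (fderiv ℝ (fderiv ℝ φ) y u w)]
  ring

theorem fderiv_christoffel_apply (h : IsometryNear G' G φ y) (w u v : E) :
    fderiv ℝ φ y (fderiv ℝ (christoffel G') y w u v) =
      fderiv ℝ (christoffel G) (φ y) (fderiv ℝ φ y w) (fderiv ℝ φ y u) (fderiv ℝ φ y v)
      + christoffel G (φ y) (fderiv ℝ (fderiv ℝ φ) y w u) (fderiv ℝ φ y v)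
      + christoffel G (φ y) (fderiv ℝ φ y u) (fderiv ℝ (fderiv ℝ φ) y w v)
      + fderiv ℝ (fderiv ℝ (fderiv ℝ φ)) y w u v
      - fderiv ℝ (fderiv ℝ φ) y w (christoffel G' y u v) := by
  have hlaw : (fun z => fderiv ℝ φ z (christoffel G' z u v)) =ᶠ[𝓝 y] fun z =>
      christoffel G (φ z) (fderiv ℝ φ z u) (fderiv ℝ φ z v) + fderiv ℝ (fderiv ℝ φ) z u v := by
    filter_upwards [h.eventually] with z hz using hz.christoffel_apply u v
  have hDφ := h.hasFDerivAt_fderiv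
  have hD2φ : DifferentiableAt ℝ (fderiv ℝ (fderiv ℝ φ)) y :=
    (h.contDiffAt_fderiv.fderiv_right (m := ∞) (by simp)).differentiableAt (by simp)
  have hΓ := HasFDerivAt.comp (g := christoffel G) y
    h.target.differentiableAt_christoffel.hasFDerivAt h.differentiableAt.hasFDerivAt
  have hright := ((hΓ.clm_apply (hDφ.clm_apply (hasFDerivAt_const u y))).clm_apply
    (hDφ.clm_apply (hasFDerivAt_const v y))).add
    (hasFDerivAt_apply₂ hD2φ u v)
  have hleft := hDφ.clm_apply (hasFDerivAt_apply₂ h.source.differentiableAt_christoffel u v)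
  have hw := DFunLike.congr_fun ((hright.congr_of_eventuallyEq hlaw).unique hleft) w
  simp only [Function.comp_apply, add_apply, ContinuousLinearMap.flip_apply,
    ContinuousLinearMap.comp_apply, zero_apply, map_zero, zero_add] at hw
  rw [eq_sub_iff_add_eq, ← hw]
  abel

theorem curvature_apply (h : IsometryNear G' G φ y) (u v z : E) :
    fderiv ℝ φ y (curvature G' y u v z) =
      curvature G (φ y) (fderiv ℝ φ y u) (fderiv ℝ φ y v) (fderiv ℝ φ y z) := by
  have hsymm : fderiv ℝ (fderiv ℝ (fderiv ℝ φ)) y u v z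
      = fderiv ℝ (fderiv ℝ (fderiv ℝ φ)) y v u z :=
    DFunLike.congr_fun ((h.contDiffAt_fderiv.isSymmSndFDerivAt
      (by simpa using ENat.LEInfty.out)).eq u v) z
  simp only [RiemInv.curvature_apply, map_add, map_sub, h.fderiv_christoffel_apply,
    h.christoffel_apply, hsymm, h.fderiv_fderiv_symm v u]
  abel

theorem curvature4_apply (h : IsometryNear G' G φ y) (u v w z : E) :
    curvature4 G' y u v w z = curvature4 G (φ y) (fderiv ℝ φ y u) (fderiv ℝ φ y v)
      (fderiv ℝ φ y w) (fderiv ℝ φ y z) := by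
  rw [curvature4, curvature4, ← h.curvature_apply, h.pullback.self_of_nhds]

theorem ricci_apply (h : IsometryNear G' G φ y) (v w : E) :
    ricci G' y v w = ricci G (φ y) (fderiv ℝ φ y v) (fderiv ℝ φ y w) := by
  obtain ⟨e, he⟩ := h.exists_equiv
  have he' (u : E) : fderiv ℝ φ y u = e u := (LinearMap.congr_fun he u).symm
  rw [RiemInv.ricci_apply, RiemInv.ricci_apply, ← LinearMap.trace_conj' (ricciEnd G' y v w) e]
  congr 1
  ext u
  have hcurv := h.curvature_apply (e.symm u) v w
  rwa [he' (e.symm u), e.apply_symm_apply, he'] at hcurv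

theorem scal_eq (h : IsometryNear G' G φ y) : scal G' y = scal G (φ y) := by
  obtain ⟨e, he⟩ := h.exists_equiv
  have he' (u : E) : e u = fderiv ℝ φ y u := LinearMap.congr_fun he u
  rw [scal_eq_trace_ricciSharp, scal_eq_trace_ricciSharp,
    ← LinearMap.trace_conj' (ricciSharp G' y) e]
  congr 1
  ext u
  apply h.target.ext
  intro w
  obtain ⟨w, rfl⟩ := e.surjective w
  obtain ⟨u, rfl⟩ := e.surjective u
  rw [h.target.ricciSharp_spec]
  simp only [LinearEquiv.conj_apply, LinearMap.comp_apply, LinearEquiv.coe_coe,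
    LinearEquiv.symm_apply_apply]
  rw [he', he', he', ← h.pullback.self_of_nhds, h.source.ricciSharp_spec, h.ricci_apply]

theorem riemPencil_apply (h : IsometryNear G' G φ y) (t a b : ℝ) (u v w z : E) :
    riemPencil G' y t a b u v w z = riemPencil G (φ y) t a b (fderiv ℝ φ y u) (fderiv ℝ φ y v)
      (fderiv ℝ φ y w) (fderiv ℝ φ y z) := by
  simp only [riemPencil, riemTensor, kulkarniNomizu, h.scal_eq, h.curvature4_apply,
    h.pullback.self_of_nhds]

end IsometryNear

end Naturality

section Scaling

variable {E : Type*} [NormedAddCommGroup E] [NormedSpace ℝ E]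
  {G : E → E →L[ℝ] E →L[ℝ] ℝ} {c : ℝ}

theorem inverse_smul {F : Type*} [NormedAddCommGroup F] [NormedSpace ℝ F] (hc : c ≠ 0)
    (A : E →L[ℝ] F) : (c • A).inverse = c⁻¹ • A.inverse := by
  have hcomp : c • A = A ∘L (ContinuousLinearEquiv.smulLeft (Units.mk0 c hc) : E ≃L[ℝ] E) := by
    ext v
    exact (map_smul A c v).symm
  rw [hcomp, ContinuousLinearMap.inverse_comp_equiv]
  rfl

set_option maxSynthPendingDepth 5 in
theorem christoffelLower_smul (c : ℝ) (G : E → E →L[ℝ] E →L[ℝ] ℝ) (y : E) :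
    christoffelLower (c • G) y = c • christoffelLower G y := by
  ext u v w
  simp only [christoffelLower_apply, fderiv_const_smul_field, Pi.smul_apply, smul_apply,
    smul_eq_mul]
  ring

theorem christoffel_smul (hc : c ≠ 0) : christoffel (c • G) = christoffel G := by
  ext y u v
  simp [christoffel_apply, christoffelLower_smul, inverse_smul hc, smul_smul, hc]

theorem curvature_smul (hc : c ≠ 0) : curvature (c • G) = curvature G := by
  ext y u v z
  simp only [curvature, christoffel_smul hc]

theorem curvature4_smul (hc : c ≠ 0) (y u v w z : E) :
    curvature4 (c • G) y u v w z = c * curvature4 G y u v w z := by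
  simp [curvature4, curvature_smul hc]

theorem ricci_smul (hc : c ≠ 0) (y : E) : ricci (c • G) y = ricci G y := by
  simp only [ricci, ricciEnd, curvature_smul hc]

variable [FiniteDimensional ℝ E]

theorem scal_smul (hc : c ≠ 0) (y : E) : scal (c • G) y = c⁻¹ * scal G y := by
  rw [scal, scal, ricci_smul hc, Pi.smul_apply, inverse_smul hc, ← smul_eq_mul, ← map_smul]
  rfl

theorem riemPencil_smul (hc : c ≠ 0) (y : E) (t a b : ℝ) (u v w z : E) :
    riemPencil (c • G) y t a b u v w z = c * riemPencil G y t (c * a) b u v w z := by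
  simp only [riemPencil, riemTensor, kulkarniNomizu, scal_smul hc, curvature4_smul hc,
    Pi.smul_apply, smul_apply, smul_eq_mul]
  field_simp

end Scaling

section Product

variable {E₁ : Type*} [NormedAddCommGroup E₁] [NormedSpace ℝ E₁]
  {E₂ : Type*} [NormedAddCommGroup E₂] [NormedSpace ℝ E₂]

/-- The orthogonal sum of two bilinear forms. -/
def prodForm (B₁ : E₁ →L[ℝ] E₁ →L[ℝ] ℝ) (B₂ : E₂ →L[ℝ] E₂ →L[ℝ] ℝ) :
    E₁ × E₂ →L[ℝ] E₁ × E₂ →L[ℝ] ℝ :=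
  B₁.bilinearComp (ContinuousLinearMap.fst ℝ E₁ E₂) (ContinuousLinearMap.fst ℝ E₁ E₂) +
    B₂.bilinearComp (ContinuousLinearMap.snd ℝ E₁ E₂) (ContinuousLinearMap.snd ℝ E₁ E₂)

theorem prodForm_apply (B₁ : E₁ →L[ℝ] E₁ →L[ℝ] ℝ) (B₂ : E₂ →L[ℝ] E₂ →L[ℝ] ℝ)
    (u v : E₁ × E₂) : prodForm B₁ B₂ u v = B₁ u.1 v.1 + B₂ u.2 v.2 := by
  simp [prodForm]

theorem apply_self_nonneg {V : Type*} [AddCommMonoid V] [Module ℝ V] {B : LinearMap.BilinForm ℝ V}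
    (hB : ∀ v, v ≠ 0 → 0 < B v v) (v : V) : 0 ≤ B v v := by
  rcases eq_or_ne v 0 with rfl | hv
  · simp
  · exact (hB v hv).le

theorem prodForm_pos {B₁ : E₁ →L[ℝ] E₁ →L[ℝ] ℝ} {B₂ : E₂ →L[ℝ] E₂ →L[ℝ] ℝ}
    (h₁ : ∀ v, v ≠ 0 → 0 < B₁ v v) (h₂ : ∀ v, v ≠ 0 → 0 < B₂ v v)
    (v : E₁ × E₂) (hv : v ≠ 0) : 0 < prodForm B₁ B₂ v v := by
  rw [prodForm_apply]
  rcases eq_or_ne v.1 0 with hfst | hfst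
  · exact add_pos_of_nonneg_of_pos (apply_self_nonneg (B := B₁.toBilinForm) h₁ _)
      (h₂ _ fun hsnd => hv (Prod.ext hfst hsnd))
  · exact add_pos_of_pos_of_nonneg (h₁ _ hfst) (apply_self_nonneg (B := B₂.toBilinForm) h₂ _)

/-- The product metric in coordinates. -/
def prodMetric (G₁ : E₁ → E₁ →L[ℝ] E₁ →L[ℝ] ℝ) (G₂ : E₂ → E₂ →L[ℝ] E₂ →L[ℝ] ℝ)
    (z : E₁ × E₂) : E₁ × E₂ →L[ℝ] E₁ × E₂ →L[ℝ] ℝ :=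
  prodForm (G₁ z.1) (G₂ z.2)

set_option maxSynthPendingDepth 5 in
theorem contDiff_bilinearComp {n : WithTop ℕ∞} (A : E₂ →L[ℝ] E₁) :
    ContDiff ℝ n (fun B : E₁ →L[ℝ] E₁ →L[ℝ] ℝ => B.bilinearComp A A) := by
  have hright : ContDiff ℝ n fun B : E₁ →L[ℝ] E₁ →L[ℝ] ℝ => (B.comp A).flip :=
    (ContinuousLinearMap.flipₗᵢ ℝ E₂ E₁ ℝ).contDiff.comp (contDiff_id.clm_comp contDiff_const)
  exact (ContinuousLinearMap.flipₗᵢ ℝ E₂ E₂ ℝ).contDiff.comp (hright.clm_comp contDiff_const)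

variable {G₁ : E₁ → E₁ →L[ℝ] E₁ →L[ℝ] ℝ} {G₂ : E₂ → E₂ →L[ℝ] E₂ →L[ℝ] ℝ} {y : E₁ × E₂}

theorem eventually_metricNear_fst_snd (h₁ : MetricNear G₁ y.1) (h₂ : MetricNear G₂ y.2) :
    ∀ᶠ z in 𝓝 y, MetricNear G₁ z.1 ∧ MetricNear G₂ z.2 :=
  ((continuousAt_fst (p := y)).eventually h₁.eventually).and
    ((continuousAt_snd (p := y)).eventually h₂.eventually)

theorem MetricNear.prod (h₁ : MetricNear G₁ y.1) (h₂ : MetricNear G₂ y.2) :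
    MetricNear (prodMetric G₁ G₂) y where
  contDiffAt := by
    filter_upwards [eventually_metricNear_fst_snd h₁ h₂] with z ⟨hz₁, hz₂⟩
    exact ((contDiff_bilinearComp _).contDiffAt.comp z
      (hz₁.contDiffAt.self_of_nhds.comp z contDiffAt_fst)).add
      ((contDiff_bilinearComp _).contDiffAt.comp z
        (hz₂.contDiffAt.self_of_nhds.comp z contDiffAt_snd))
  symm := by
    filter_upwards [eventually_metricNear_fst_snd h₁ h₂] with z ⟨hz₁, hz₂⟩ u v
    rw [prodMetric, prodForm_apply, prodForm_apply, hz₁.apply_comm, hz₂.apply_comm]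
  pos := by
    filter_upwards [eventually_metricNear_fst_snd h₁ h₂] with z ⟨hz₁, hz₂⟩
    exact prodForm_pos hz₁.pos.self_of_nhds hz₂.pos.self_of_nhds

theorem fderiv_prodMetric (h₁ : MetricNear G₁ y.1) (h₂ : MetricNear G₂ y.2) (u v w : E₁ × E₂) :
    fderiv ℝ (prodMetric G₁ G₂) y u v w =
      fderiv ℝ G₁ y.1 u.1 v.1 w.1 + fderiv ℝ G₂ y.2 u.2 v.2 w.2 := by
  rw [fderiv_apply₂ (h₁.prod h₂).differentiableAt]
  simp only [prodMetric, prodForm_apply]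
  exact DFunLike.congr_fun
    (((hasFDerivAt_apply₂ h₁.differentiableAt v.1 w.1).comp y hasFDerivAt_fst).add
      ((hasFDerivAt_apply₂ h₂.differentiableAt v.2 w.2).comp y hasFDerivAt_snd)).fderiv u

variable [FiniteDimensional ℝ E₁] [FiniteDimensional ℝ E₂]

theorem christoffel_prodMetric (h₁ : MetricNear G₁ y.1) (h₂ : MetricNear G₂ y.2)
    (u v : E₁ × E₂) : christoffel (prodMetric G₁ G₂) y u v =
      (christoffel G₁ y.1 u.1 v.1, christoffel G₂ y.2 u.2 v.2) := by
  apply (h₁.prod h₂).ext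
  intro w
  rw [(h₁.prod h₂).christoffel_spec, christoffelLower_apply, fderiv_prodMetric h₁ h₂,
    fderiv_prodMetric h₁ h₂, fderiv_prodMetric h₁ h₂, prodMetric, prodForm_apply,
    h₁.christoffel_spec, h₂.christoffel_spec, christoffelLower_apply, christoffelLower_apply]
  ring

theorem fderiv_christoffel_prodMetric (h₁ : MetricNear G₁ y.1) (h₂ : MetricNear G₂ y.2)
    (w u v : E₁ × E₂) : fderiv ℝ (christoffel (prodMetric G₁ G₂)) y w u v =
      (fderiv ℝ (christoffel G₁) y.1 w.1 u.1 v.1, fderiv ℝ (christoffel G₂) y.2 w.2 u.2 v.2) := by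
  have hprod : (fun z => christoffel (prodMetric G₁ G₂) z u v) =ᶠ[𝓝 y]
      fun z => (christoffel G₁ z.1 u.1 v.1, christoffel G₂ z.2 u.2 v.2) := by
    filter_upwards [eventually_metricNear_fst_snd h₁ h₂] with z ⟨hz₁, hz₂⟩
      using christoffel_prodMetric hz₁ hz₂ u v
  have hleft := hasFDerivAt_apply₂ (h₁.prod h₂).differentiableAt_christoffel u v
  have hright :=
    ((hasFDerivAt_apply₂ h₁.differentiableAt_christoffel u.1 v.1).comp y hasFDerivAt_fst).prodMk
      ((hasFDerivAt_apply₂ h₂.differentiableAt_christoffel u.2 v.2).comp y hasFDerivAt_snd)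
  exact DFunLike.congr_fun (hleft.unique (hright.congr_of_eventuallyEq hprod)) w

theorem curvature_prodMetric (h₁ : MetricNear G₁ y.1) (h₂ : MetricNear G₂ y.2)
    (u v z : E₁ × E₂) : curvature (prodMetric G₁ G₂) y u v z =
      (curvature G₁ y.1 u.1 v.1 z.1, curvature G₂ y.2 u.2 v.2 z.2) := by
  simp only [curvature_apply, christoffel_prodMetric h₁ h₂, fderiv_christoffel_prodMetric h₁ h₂]
  rfl

theorem curvature4_prodMetric (h₁ : MetricNear G₁ y.1) (h₂ : MetricNear G₂ y.2)
    (u v w z : E₁ × E₂) : curvature4 (prodMetric G₁ G₂) y u v w z =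
      curvature4 G₁ y.1 u.1 v.1 w.1 z.1 + curvature4 G₂ y.2 u.2 v.2 w.2 z.2 := by
  rw [curvature4, curvature_prodMetric h₁ h₂, prodMetric, prodForm_apply]
  rfl

theorem ricci_prodMetric (h₁ : MetricNear G₁ y.1) (h₂ : MetricNear G₂ y.2) (v w : E₁ × E₂) :
    ricci (prodMetric G₁ G₂) y v w = ricci G₁ y.1 v.1 w.1 + ricci G₂ y.2 v.2 w.2 := by
  rw [ricci_apply, ricci_apply, ricci_apply, ← LinearMap.trace_prodMap']
  congr 1
  apply LinearMap.ext
  intro u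
  exact curvature_prodMetric h₁ h₂ u v w

theorem scal_prodMetric (h₁ : MetricNear G₁ y.1) (h₂ : MetricNear G₂ y.2) :
    scal (prodMetric G₁ G₂) y = scal G₁ y.1 + scal G₂ y.2 := by
  simp only [scal_eq_trace_ricciSharp]
  rw [← LinearMap.trace_prodMap']
  congr 1
  apply LinearMap.ext
  intro u
  apply (h₁.prod h₂).ext
  intro w
  rw [(h₁.prod h₂).ricciSharp_spec, ricci_prodMetric h₁ h₂, prodMetric, prodForm_apply,
    LinearMap.prodMap_apply, h₁.ricciSharp_spec, h₂.ricciSharp_spec]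

theorem riemTensor_prodMetric (h₁ : MetricNear G₁ y.1) (h₂ : MetricNear G₂ y.2) (t : ℝ)
    (u v w z : E₁ × E₂) :
    riemTensor (prodMetric G₁ G₂) y t u v w z =
      riemPencil G₁ y.1 t (scal G₂ y.2) 1 u.1 v.1 w.1 z.1
        + riemPencil G₂ y.2 t (scal G₁ y.1) 1 u.2 v.2 w.2 z.2
        + (scal G₁ y.1 + scal G₂ y.2) * kulkarniNomizu
          ((G₁ y.1).bilinearComp (ContinuousLinearMap.fst ℝ E₁ E₂)
            (ContinuousLinearMap.fst ℝ E₁ E₂))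
          ((G₂ y.2).bilinearComp (ContinuousLinearMap.snd ℝ E₁ E₂)
            (ContinuousLinearMap.snd ℝ E₁ E₂)) u v w z := by
  simp only [riemTensor, riemPencil, kulkarniNomizu, scal_prodMetric h₁ h₂,
    curvature4_prodMetric h₁ h₂, prodMetric, prodForm_apply,
    ContinuousLinearMap.bilinearComp_apply, ContinuousLinearMap.coe_fst',
    ContinuousLinearMap.coe_snd']
  ring

end Product

section Wedge

variable {R E F V : Type*} [CommRing R] [AddCommGroup E] [Module R E] [AddCommGroup F] [Module R F]
  [AddCommGroup V] [Module R V]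

/-- The exterior product `u ∧ v` of two vectors, as a bilinear map. -/
def wedge : E →ₗ[R] E →ₗ[R] ⋀[R]^2 E :=
  LinearMap.mk₂ R (fun u v => exteriorPower.ιMulti R 2 ![u, v])
    (fun u u' v => (exteriorPower.ιMulti R 2).map_vecCons_add (![v] : Fin 1 → E) u u')
    (fun c u v => (exteriorPower.ιMulti R 2).map_vecCons_smul (![v] : Fin 1 → E) c u)
    (fun u v v' => ((exteriorPower.ιMulti R 2).curryLeft u).map_vecCons_add ![] v v')
    (fun c u v => ((exteriorPower.ιMulti R 2).curryLeft u).map_vecCons_smul ![] c v)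

theorem wedge_apply (u v : E) : wedge u v = exteriorPower.ιMulti R 2 ![u, v] := rfl

theorem wedge_isAlt : (wedge : E →ₗ[R] E →ₗ[R] ⋀[R]^2 E).IsAlt := fun u =>
  (exteriorPower.ιMulti R 2).map_eq_zero_of_eq ![u, u] (i := 0) (j := 1) rfl Fin.zero_ne_one

theorem bivector_hom_ext {L L' : ⋀[R]^2 E →ₗ[R] V}
    (hL : ∀ u v, L (wedge u v) = L' (wedge u v)) : L = L' := by
  refine exteriorPower.linearMap_ext (AlternatingMap.ext fun m => ?_)
  have hm : m = ![m 0, m 1] := by ext i; fin_cases i <;> rfl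
  rw [hm]
  exact hL _ _

theorem exists_sum_wedge_eq (η : ⋀[R]^2 E) :
    ∃ (k : ℕ) (x y : Fin k → E), ∑ a, wedge (x a) (y a) = η := by
  have hη : η ∈ Submodule.span R (Set.range (exteriorPower.ιMulti R 2)) := by
    rw [exteriorPower.ιMulti_span]
    trivial
  obtain ⟨k, c, m, hsum⟩ := Submodule.mem_span_set'.1 hη
  choose w hw using fun a => (m a).2
  refine ⟨k, fun a => c a • w a 0, fun a => w a 1, ?_⟩
  rw [← hsum]
  refine Finset.sum_congr rfl fun a _ => ?_
  have hwa : w a = ![w a 0, w a 1] := by ext i; fin_cases i <;> rfl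
  rw [map_smul, LinearMap.smul_apply, wedge_apply, ← hwa, hw]

/-- The linear map on bivectors with `u ∧ v ↦ S u v`, for an alternating bilinear map `S`. -/
def wedgeLift (S : E →ₗ[R] E →ₗ[R] V) (hS : S.IsAlt) : ⋀[R]^2 E →ₗ[R] V :=
  exteriorPower.alternatingMapLinearEquiv
    { toFun := fun m => S (m 0) (m 1)
      map_update_add' := fun m i u v => by fin_cases i <;> simp
      map_update_smul' := fun m i c u => by fin_cases i <;> simp
      map_eq_zero_of_eq' := fun m i j hij hne => by
        have h01 : m 0 = m 1 := by fin_cases i <;> fin_cases j <;> simp_all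
        exact h01 ▸ hS _ }

theorem wedgeLift_wedge (S : E →ₗ[R] E →ₗ[R] V) (hS : S.IsAlt) (u v : E) :
    wedgeLift S hS (wedge u v) = S u v :=
  exteriorPower.alternatingMapLinearEquiv_apply_ιMulti _ _

theorem exteriorPower_map_wedge (A : E →ₗ[R] F) (u v : E) :
    exteriorPower.map 2 A (wedge u v) = wedge (A u) (A v) := by
  rw [wedge_apply, exteriorPower.map_apply_ιMulti, wedge_apply]
  congr 1
  ext i
  fin_cases i <;> rfl

/-- The contraction of bivectors with a covector: `u ∧ v ↦ φ v • u - φ u • v`. -/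
def contract (φ : E →ₗ[R] R) : ⋀[R]^2 E →ₗ[R] E :=
  wedgeLift (LinearMap.mk₂ R (fun u v => φ v • u - φ u • v)
    (fun u u' v => by rw [map_add]; module) (fun c u v => by rw [map_smul, smul_eq_mul]; module)
    (fun u v v' => by rw [map_add]; module) (fun c u v => by rw [map_smul, smul_eq_mul]; module))
    fun u => sub_self _

theorem contract_wedge (φ : E →ₗ[R] R) (u v : E) :
    contract φ (wedge u v) = φ v • u - φ u • v :=
  wedgeLift_wedge _ _ u v

variable {ι : Type*} [Fintype ι]

theorem sum_contract_coord_wedge (b : Module.Basis ι R E) (η : ⋀[R]^2 E) :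
    ∑ j, wedge (contract (b.coord j) η) (b j) = (2 : R) • η := by
  have hmap : ∑ j, wedge.flip (b j) ∘ₗ contract (b.coord j) =
      (2 : R) • (LinearMap.id : ⋀[R]^2 E →ₗ[R] ⋀[R]^2 E) := by
    refine bivector_hom_ext fun u v => ?_
    calc (∑ j, wedge.flip (b j) ∘ₗ contract (b.coord j)) (wedge u v)
        = wedge u (∑ j, b.coord j v • b j) - wedge v (∑ j, b.coord j u • b j) := by
          simp only [LinearMap.sum_apply, LinearMap.comp_apply, LinearMap.flip_apply,
            contract_wedge, map_sub, map_smul, Finset.sum_sub_distrib, map_sum]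
      _ = wedge u v - wedge v u := by simp only [Module.Basis.coord_apply, b.sum_repr]
      _ = (2 : R) • wedge u v := by rw [← wedge_isAlt.neg u v]; module
  simpa [LinearMap.sum_apply] using LinearMap.congr_fun hmap η

theorem bivector_prod_decomposition (b : Module.Basis ι R F) (η : ⋀[R]^2 (E × F)) :
    exteriorPower.map 2 (LinearMap.inl R E F) (exteriorPower.map 2 (LinearMap.fst R E F) η)
      + exteriorPower.map 2 (LinearMap.inr R E F) (exteriorPower.map 2 (LinearMap.snd R E F) η)
      + ∑ j, wedge ((contract (b.coord j ∘ₗ LinearMap.snd R E F) η).1, (0 : F)) (0, b j) = η := by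
  have hmap : exteriorPower.map 2 (LinearMap.inl R E F) ∘ₗ
        exteriorPower.map 2 (LinearMap.fst R E F)
      + exteriorPower.map 2 (LinearMap.inr R E F) ∘ₗ exteriorPower.map 2 (LinearMap.snd R E F)
      + ∑ j, wedge.flip (0, b j) ∘ₗ LinearMap.inl R E F ∘ₗ LinearMap.fst R E F ∘ₗ
          contract (b.coord j ∘ₗ LinearMap.snd R E F) = LinearMap.id := by
    refine bivector_hom_ext fun ⟨u₁, u₂⟩ ⟨v₁, v₂⟩ => ?_
    have hmixed : ∀ (x : E) (w : F),
        ∑ j, b.coord j w • (wedge (x, (0 : F)) (0, b j) : ⋀[R]^2 (E × F)) =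
          wedge (x, 0) (0, w) := by
      intro x w
      conv_rhs => rw [← LinearMap.inr_apply (R := R), ← b.sum_repr w]
      simp only [Module.Basis.coord_apply, map_sum, map_smul, LinearMap.inr_apply]
    have hsum : ∑ j, wedge (b.coord j v₂ • u₁ - b.coord j u₂ • v₁, (0 : F)) ((0 : E), b j) =
        (wedge (u₁, 0) (0, v₂) - wedge (v₁, 0) (0, u₂) : ⋀[R]^2 (E × F)) := by
      rw [← hmixed, ← hmixed, ← Finset.sum_sub_distrib]
      simp only [← LinearMap.inl_apply (R := R), map_sub, map_smul, LinearMap.sub_apply,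
        LinearMap.smul_apply]
    have hsplit : ∀ (x : E) (w : F), (x, w) = (x, (0 : F)) + ((0 : E), w) := fun x w => by simp
    simp only [LinearMap.add_apply, LinearMap.sum_apply, LinearMap.comp_apply,
      LinearMap.flip_apply, exteriorPower_map_wedge, contract_wedge, LinearMap.fst_apply,
      LinearMap.snd_apply, LinearMap.inl_apply, LinearMap.inr_apply, LinearMap.id_apply,
      Prod.smul_mk, Prod.mk_sub_mk, hsum]
    rw [hsplit u₁ u₂, hsplit v₁ v₂, sub_eq_add_neg, wedge_isAlt.neg]
    simp only [map_add, LinearMap.add_apply]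
    abel
  simpa [LinearMap.sum_apply] using LinearMap.congr_fun hmap η

end Wedge

section BivectorForms

variable {E F : Type*} [NormedAddCommGroup E] [NormedSpace ℝ E] [NormedAddCommGroup F]
  [NormedSpace ℝ F]

/-- The 4-tensor `(u, v, w, z) ↦ Q (u ∧ v, w ∧ z)` of a bilinear form `Q` on bivectors. -/
def bivectorTensor (Q : LinearMap.BilinForm ℝ (⋀[ℝ]^2 E)) (u v w z : E) : ℝ :=
  Q (wedge u v) (wedge w z)

theorem posDefOnBivectors_bivectorTensor {Q : LinearMap.BilinForm ℝ (⋀[ℝ]^2 E)} :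
    PosDefOnBivectors (bivectorTensor Q) ↔ ∀ η, η ≠ 0 → 0 < Q η η := by
  have hsum : ∀ (k : ℕ) (x y : Fin k → E),
      ∑ a, ∑ b, bivectorTensor Q (x a) (y a) (x b) (y b) =
        Q (∑ a, wedge (x a) (y a)) (∑ a, wedge (x a) (y a)) := fun k x y => by
    simp only [bivectorTensor, map_sum, LinearMap.sum_apply]
    exact Finset.sum_comm
  constructor
  · intro hQ η hη
    obtain ⟨k, x, y, rfl⟩ := exists_sum_wedge_eq η
    exact hsum k x y ▸ hQ k x y hη
  · intro hQ k x y hxy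
    exact hsum k x y ▸ hQ _ hxy

/-- The 4-tensors induced by bilinear forms on bivectors. -/
def IsBivectorForm (T : E → E → E → E → ℝ) : Prop :=
  ∃ Q : LinearMap.BilinForm ℝ (⋀[ℝ]^2 E), T = bivectorTensor Q

theorem exists_linearMap_wedge_eq {V : Type*} [AddCommGroup V] [Module ℝ V] {S : E → E → V}
    (hS : ∀ v, IsLinearMap ℝ fun u => S u v) (hS_alt : ∀ u v, S u v = -S v u) :
    ∃ L : ⋀[ℝ]^2 E →ₗ[ℝ] V, ∀ u v, L (wedge u v) = S u v := by
  have : IsAddTorsionFree V := .of_isTorsionFree ℝ V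
  let S' : E →ₗ[ℝ] E →ₗ[ℝ] V := LinearMap.mk₂ ℝ S (fun u u' v => (hS v).map_add u u')
    (fun c u v => (hS v).map_smul c u)
    (fun u v v' => by rw [hS_alt, (hS u).map_add, neg_add, ← hS_alt, ← hS_alt])
    (fun c u v => by rw [hS_alt, (hS u).map_smul, ← smul_neg, ← hS_alt])
  exact ⟨wedgeLift S' fun u => self_eq_neg.1 (hS_alt u u), wedgeLift_wedge S' _⟩

theorem isBivectorForm_of_isLinearMap {T : E → E → E → E → ℝ}
    (hfst : ∀ v w z, IsLinearMap ℝ fun u => T u v w z)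
    (hfst_alt : ∀ u v w z, T u v w z = -T v u w z)
    (hsnd : ∀ u v z, IsLinearMap ℝ fun w => T u v w z)
    (hsnd_alt : ∀ u v w z, T u v w z = -T u v z w) : IsBivectorForm T := by
  choose L hL using fun u v => exists_linearMap_wedge_eq (hsnd u v) (hsnd_alt u v)
  obtain ⟨Q, hQ⟩ := exists_linearMap_wedge_eq (S := L)
    (fun v => ⟨fun u u' => bivector_hom_ext fun w z => by
        simpa only [LinearMap.add_apply, hL] using (hfst v w z).map_add u u',
      fun c u => bivector_hom_ext fun w z => by
        simpa only [LinearMap.smul_apply, hL] using (hfst v w z).map_smul c u⟩)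
    (fun u v => bivector_hom_ext fun w z => by
      simpa only [LinearMap.neg_apply, hL] using hfst_alt u v w z)
  refine ⟨Q, ?_⟩
  ext u v w z
  rw [bivectorTensor, hQ, hL]

theorem IsBivectorForm.add {T T' : E → E → E → E → ℝ} (hT : IsBivectorForm T)
    (hT' : IsBivectorForm T') : IsBivectorForm fun u v w z => T u v w z + T' u v w z := by
  obtain ⟨⟨Q, rfl⟩, Q', rfl⟩ := And.intro hT hT'
  exact ⟨Q + Q', rfl⟩

theorem IsBivectorForm.const_mul {T : E → E → E → E → ℝ} (hT : IsBivectorForm T) (c : ℝ) :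
    IsBivectorForm fun u v w z => c * T u v w z := by
  obtain ⟨Q, rfl⟩ := hT
  exact ⟨c • Q, rfl⟩

theorem PosDefOnBivectors.const_mul {T : E → E → E → E → ℝ} (hT : PosDefOnBivectors T) {c : ℝ}
    (hc : 0 < c) : PosDefOnBivectors fun u v w z => c * T u v w z := fun k x y hxy => by
  simpa only [Finset.mul_sum] using mul_pos hc (hT k x y hxy)

theorem PosDefOnBivectors.comp_equiv {T : E → E → E → E → ℝ} (hT : PosDefOnBivectors T)
    (e : F ≃ₗ[ℝ] E) : PosDefOnBivectors fun u v w z => T (e u) (e v) (e w) (e z) := by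
  refine fun k x y hxy => hT k (fun a => e (x a)) (fun a => e (y a)) fun h0 => hxy ?_
  simp only [← wedge_apply] at h0 ⊢
  rw [← map_zero (exteriorPower.map 2 e.symm.toLinearMap), ← h0, map_sum]
  simp [exteriorPower_map_wedge]

theorem exists_orthogonal_coordinates [FiniteDimensional ℝ E] {B : E →L[ℝ] E →L[ℝ] ℝ}
    (hsymm : ∀ u v, B u v = B v u) (hpos : ∀ v, v ≠ 0 → 0 < B v v) :
    ∃ (b : Module.Basis (Fin (Module.finrank ℝ E)) ℝ E) (c : Fin (Module.finrank ℝ E) → ℝ),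
      (∀ i, 0 < c i) ∧ ∀ u v, B u v = ∑ i, c i * (b.coord i u * b.coord i v) := by
  obtain ⟨b, hb⟩ := LinearMap.BilinForm.exists_orthogonal_basis (B := B.toBilinForm)
    ⟨fun u v => hsymm u v⟩
  refine ⟨b, fun i => B (b i) (b i), fun i => hpos _ (b.ne_zero i), fun u v => ?_⟩
  have hortho : ∀ i j, i ≠ j → B (b i) (b j) = 0 := fun i j hij => hb hij
  simp only [Module.Basis.coord_apply]
  conv_lhs => arg 2; rw [← b.sum_repr v]
  conv_lhs => arg 1; rw [← b.sum_repr u]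
  simp only [map_sum, FunLike.coe_sum, Finset.sum_apply, map_smul, FunLike.coe_smul, Pi.smul_apply,
    smul_eq_mul]
  refine Finset.sum_congr rfl fun i _ => ?_
  rw [Finset.sum_eq_single i (fun j _ hji => by rw [hortho j i hji]; ring) (by simp)]
  ring

/-- The form `(η, ξ) ↦ ∑ j, c j * h (φ j ⌟ η, φ j ⌟ ξ)` on bivectors; it induces the
Kulkarni--Nomizu product of `h` and `∑ j, c j • φ j ⊗ φ j`. -/
def contractionForm {ι : Type*} [Fintype ι] (h : E →L[ℝ] E →L[ℝ] ℝ) (c : ι → ℝ)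
    (φ : ι → E →ₗ[ℝ] ℝ) : LinearMap.BilinForm ℝ (⋀[ℝ]^2 E) :=
  ∑ j, c j • h.toBilinForm.compl₁₂ (contract (φ j)) (contract (φ j))

section Contraction

variable {ι : Type*} [Fintype ι] {c : ι → ℝ} {φ : ι → E →ₗ[ℝ] ℝ}

theorem contractionForm_apply (h : E →L[ℝ] E →L[ℝ] ℝ) (η ξ : ⋀[ℝ]^2 E) :
    contractionForm h c φ η ξ = ∑ j, c j * h (contract (φ j) η) (contract (φ j) ξ) := by
  simp [contractionForm, LinearMap.sum_apply]

theorem kulkarniNomizu_eq_bivectorTensor (h : E →L[ℝ] E →L[ℝ] ℝ) {k : E →L[ℝ] E →L[ℝ] ℝ}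
    (hk : ∀ u v, k u v = ∑ j, c j * (φ j u * φ j v)) :
    kulkarniNomizu h k = bivectorTensor (contractionForm h c φ) := by
  ext u v w z
  simp only [kulkarniNomizu, bivectorTensor, contractionForm_apply, contract_wedge, hk,
    Finset.mul_sum, ← Finset.sum_add_distrib, ← Finset.sum_sub_distrib, map_sub, map_smul,
    sub_apply, smul_apply, smul_eq_mul]
  exact Finset.sum_congr rfl fun j _ => by ring

end Contraction

section KulkarniNomizuSelf

variable [FiniteDimensional ℝ E] {B : E →L[ℝ] E →L[ℝ] ℝ}

theorem isBivectorForm_kulkarniNomizu_self (hsymm : ∀ u v, B u v = B v u)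
    (hpos : ∀ v, v ≠ 0 → 0 < B v v) : IsBivectorForm (kulkarniNomizu B B) := by
  obtain ⟨b, c, -, hB⟩ := exists_orthogonal_coordinates hsymm hpos
  exact ⟨_, kulkarniNomizu_eq_bivectorTensor B hB⟩

theorem posDefOnBivectors_kulkarniNomizu_self (hsymm : ∀ u v, B u v = B v u)
    (hpos : ∀ v, v ≠ 0 → 0 < B v v) : PosDefOnBivectors (kulkarniNomizu B B) := by
  obtain ⟨b, c, hc, hB⟩ := exists_orthogonal_coordinates hsymm hpos
  rw [kulkarniNomizu_eq_bivectorTensor B hB, posDefOnBivectors_bivectorTensor]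
  intro η hη
  obtain ⟨j, hj⟩ : ∃ j, contract (b.coord j) η ≠ 0 := by
    by_contra! h0
    refine hη (smul_right_injective _ (two_ne_zero (α := ℝ)) ?_)
    simp only [← sum_contract_coord_wedge b η, h0, map_zero, LinearMap.zero_apply,
      Finset.sum_const_zero, smul_zero]
  rw [contractionForm_apply]
  exact Finset.sum_pos'
    (fun i _ => mul_nonneg (hc i).le (apply_self_nonneg (B := B.toBilinForm) hpos _))
    ⟨j, Finset.mem_univ j, mul_pos (hc j) (hpos _ hj)⟩

end KulkarniNomizuSelf

theorem apply_self_prod_pos {V W : Type*} [AddCommGroup V] [Module ℝ V] [AddCommGroup W]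
    [Module ℝ W] {ι : Type*} [Fintype ι] (b : Module.Basis ι ℝ W) {c : ι → ℝ} (hc : ∀ j, 0 < c j)
    {Q₁ : LinearMap.BilinForm ℝ (⋀[ℝ]^2 V)} (hQ₁ : ∀ η, η ≠ 0 → 0 < Q₁ η η)
    {Q₂ : LinearMap.BilinForm ℝ (⋀[ℝ]^2 W)} (hQ₂ : ∀ η, η ≠ 0 → 0 < Q₂ η η)
    {A : LinearMap.BilinForm ℝ V} (hA : ∀ u, u ≠ 0 → 0 < A u u) {s : ℝ} (hs : 0 < s)
    {η : ⋀[ℝ]^2 (V × W)} (hη : η ≠ 0) :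
    0 < Q₁ (exteriorPower.map 2 (LinearMap.fst ℝ V W) η)
          (exteriorPower.map 2 (LinearMap.fst ℝ V W) η) +
        Q₂ (exteriorPower.map 2 (LinearMap.snd ℝ V W) η)
          (exteriorPower.map 2 (LinearMap.snd ℝ V W) η) +
        s * ∑ j, c j * A (contract (b.coord j ∘ₗ LinearMap.snd ℝ V W) η).1
          (contract (b.coord j ∘ₗ LinearMap.snd ℝ V W) η).1 := by
  set η₁ := exteriorPower.map 2 (LinearMap.fst ℝ V W) η with hη₁_def
  set η₂ := exteriorPower.map 2 (LinearMap.snd ℝ V W) η with hη₂_def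
  set mixed : ι → V := fun j => (contract (b.coord j ∘ₗ LinearMap.snd ℝ V W) η).1
  have hterm : ∀ j, 0 ≤ c j * A (mixed j) (mixed j) := fun j =>
    mul_nonneg (hc j).le (apply_self_nonneg hA _)
  have hsum := mul_nonneg hs.le (Finset.sum_nonneg fun j (_ : j ∈ Finset.univ) => hterm j)
  have hη₁ := apply_self_nonneg hQ₁ η₁
  have hη₂ := apply_self_nonneg hQ₂ η₂
  by_contra! hle
  have hη₁_zero : η₁ = 0 := by
    by_contra h0
    linarith [hQ₁ _ h0]
  have hη₂_zero : η₂ = 0 := by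
    by_contra h0
    linarith [hQ₂ _ h0]
  have hmixed_zero : ∀ j, mixed j = 0 := by
    by_contra! ⟨j, hj⟩
    linarith [mul_pos hs (Finset.sum_pos' (fun j _ => hterm j)
      ⟨j, Finset.mem_univ j, mul_pos (hc j) (hA _ hj)⟩)]
  refine hη ?_
  rw [← bivector_prod_decomposition b η, ← hη₁_def, ← hη₂_def, hη₁_zero, hη₂_zero, map_zero,
    map_zero, add_zero, zero_add]
  refine Finset.sum_eq_zero fun j _ => ?_
  rw [show (contract (b.coord j ∘ₗ LinearMap.snd ℝ V W) η).1 = 0 from hmixed_zero j,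
    Prod.mk_zero_zero, map_zero, LinearMap.zero_apply]

theorem posDefOnBivectors_prod {T₁ : E → E → E → E → ℝ} {T₂ : F → F → F → F → ℝ}
    [FiniteDimensional ℝ F] {A : E →L[ℝ] E →L[ℝ] ℝ} {B : F →L[ℝ] F →L[ℝ] ℝ}
    (hT₁ : IsBivectorForm T₁) (hT₁_pos : PosDefOnBivectors T₁)
    (hT₂ : IsBivectorForm T₂) (hT₂_pos : PosDefOnBivectors T₂)
    (hA_pos : ∀ u, u ≠ 0 → 0 < A u u) (hB_symm : ∀ u v, B u v = B v u)
    (hB_pos : ∀ u, u ≠ 0 → 0 < B u u) {s : ℝ} (hs : 0 < s) :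
    PosDefOnBivectors fun u v w z : E × F => T₁ u.1 v.1 w.1 z.1 + T₂ u.2 v.2 w.2 z.2 +
      s * kulkarniNomizu
        (A.bilinearComp (ContinuousLinearMap.fst ℝ E F) (ContinuousLinearMap.fst ℝ E F))
        (B.bilinearComp (ContinuousLinearMap.snd ℝ E F) (ContinuousLinearMap.snd ℝ E F))
        u v w z := by
  obtain ⟨⟨Q₁, rfl⟩, Q₂, rfl⟩ := And.intro hT₁ hT₂
  rw [posDefOnBivectors_bivectorTensor] at hT₁_pos hT₂_pos
  obtain ⟨b, c, hc, hB⟩ := exists_orthogonal_coordinates hB_symm hB_pos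
  let A' := A.bilinearComp (ContinuousLinearMap.fst ℝ E F) (ContinuousLinearMap.fst ℝ E F)
  let φ j := b.coord j ∘ₗ LinearMap.snd ℝ E F
  let π₁ := exteriorPower.map 2 (LinearMap.fst ℝ E F)
  let π₂ := exteriorPower.map 2 (LinearMap.snd ℝ E F)
  have hsum : (fun u v w z : E × F => bivectorTensor Q₁ u.1 v.1 w.1 z.1 +
      bivectorTensor Q₂ u.2 v.2 w.2 z.2 + s * kulkarniNomizu A'
        (B.bilinearComp (ContinuousLinearMap.snd ℝ E F) (ContinuousLinearMap.snd ℝ E F)) u v w z) =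
      bivectorTensor (Q₁.compl₁₂ π₁ π₁ + Q₂.compl₁₂ π₂ π₂ + s • contractionForm A' c φ) := by
    rw [kulkarniNomizu_eq_bivectorTensor (φ := φ) A' fun u v => hB u.2 v.2]
    ext u v w z
    simp [bivectorTensor, π₁, π₂, exteriorPower_map_wedge]
  rw [hsum, posDefOnBivectors_bivectorTensor]
  intro η hη
  simp only [LinearMap.add_apply, LinearMap.smul_apply, LinearMap.compl₁₂_apply, smul_eq_mul,
    contractionForm_apply]
  exact apply_self_prod_pos (A := A.toBilinForm) b hc hT₁_pos hT₂_pos hA_pos hs hη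

theorem eventually_forall_apply_self_pos {V : Type*} [AddCommGroup V] [Module ℝ V]
    [FiniteDimensional ℝ V] {X : Type*} [TopologicalSpace X] {x₀ : X}
    {Q : X → LinearMap.BilinForm ℝ V} (hQ : ∀ η ξ, ContinuousAt (fun x => Q x η ξ) x₀)
    (hpos : ∀ η, η ≠ 0 → 0 < Q x₀ η η) : ∀ᶠ x in 𝓝 x₀, ∀ η, η ≠ 0 → 0 < Q x η η := by
  let b := Module.finBasis ℝ V
  let vec (a : Fin (Module.finrank ℝ V) → ℝ) : V := b.equivFun.symm a
  have hcont : ∀ a, ContinuousAt (fun x : X × _ => Q x.1 (vec x.2) (vec x.2)) (x₀, a) := by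
    intro a
    simp only [vec, Module.Basis.equivFun_symm_apply, map_sum, LinearMap.sum_apply, map_smul,
      LinearMap.smul_apply, smul_eq_mul]
    have hQ' : ∀ i j, ContinuousAt
        (fun x : X × (Fin (Module.finrank ℝ V) → ℝ) => Q x.1 (b i) (b j)) (x₀, a) :=
      fun i j => ContinuousAt.comp (g := fun x => Q x (b i) (b j)) (hQ _ _) continuousAt_fst
    fun_prop
  have hsphere : ∀ᶠ x in 𝓝 x₀, ∀ a ∈ Metric.sphere 0 1, 0 < Q x (vec a) (vec a) := by
    refine (isCompact_sphere _ _).eventually_forall_of_forall_eventually fun a ha => ?_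
    refine (hcont a).eventually (lt_mem_nhds (hpos _ ?_))
    exact (b.equivFun.symm.map_ne_zero_iff).2 (ne_zero_of_mem_unit_sphere ⟨a, ha⟩)
  filter_upwards [hsphere] with x hx η hη
  let a := b.equivFun η
  have ha : a ≠ 0 := b.equivFun.map_ne_zero_iff.2 hη
  have hscaled := hx (‖a‖⁻¹ • a) (by simp [norm_smul, ha])
  simp only [vec, a, map_smul, LinearEquiv.symm_apply_apply, LinearMap.smul_apply,
    smul_eq_mul] at hscaled
  exact pos_of_mul_pos_right (pos_of_mul_pos_right hscaled (by positivity)) (by positivity)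

theorem PosDefOnBivectors.eventually [FiniteDimensional ℝ E] {X : Type*} [TopologicalSpace X]
    {x₀ : X} {T : X → E → E → E → E → ℝ} (hT : ∀ᶠ x in 𝓝 x₀, IsBivectorForm (T x))
    (hcont : ∀ u v w z, ContinuousAt (fun x => T x u v w z) x₀) (hpos : PosDefOnBivectors (T x₀)) :
    ∀ᶠ x in 𝓝 x₀, PosDefOnBivectors (T x) := by
  obtain ⟨Q, hQ⟩ := hT.choice
  rw [hQ.self_of_nhds, posDefOnBivectors_bivectorTensor] at hpos
  have hQ_cont : ∀ η ξ, ContinuousAt (fun x => Q x η ξ) x₀ := by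
    intro η ξ
    obtain ⟨⟨k, u, v, rfl⟩, l, w, z, rfl⟩ :=
      And.intro (exists_sum_wedge_eq η) (exists_sum_wedge_eq ξ)
    simp only [map_sum, LinearMap.sum_apply]
    refine tendsto_finsetSum _ fun i _ => tendsto_finsetSum _ fun j _ => ?_
    refine ContinuousAt.congr (hcont (u j) (v j) (w i) (z i)) ?_
    filter_upwards [hQ] with x hx
    rw [hx, bivectorTensor]
  filter_upwards [hQ, eventually_forall_apply_self_pos hQ_cont hpos] with x hx hx_pos
  rwa [hx, posDefOnBivectors_bivectorTensor]

end BivectorForms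

section CurvatureContinuity

variable {E : Type*} [NormedAddCommGroup E] [NormedSpace ℝ E]

theorem continuousAt_trace [FiniteDimensional ℝ E] {X : Type*} [TopologicalSpace X] {x₀ : X}
    {A : X → E →ₗ[ℝ] E} (hA : ∀ v, ContinuousAt (fun x => A x v) x₀) :
    ContinuousAt (fun x => LinearMap.trace ℝ E (A x)) x₀ := by
  have hA' : ContinuousAt (fun x => LinearMap.toContinuousLinearMap (A x)) x₀ :=
    continuousAt_clm_apply.2 hA
  let trace : (E →L[ℝ] E) →ₗ[ℝ] ℝ := LinearMap.trace ℝ E ∘ₗ ContinuousLinearMap.coeLM ℝ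
  exact (LinearMap.continuous_of_finiteDimensional trace).continuousAt.comp hA'

variable {G : E → E →L[ℝ] E →L[ℝ] ℝ} {y : E}

namespace MetricNear

theorem continuousAt_kulkarniNomizu (h : MetricNear G y) (u v w z : E) :
    ContinuousAt (fun x => kulkarniNomizu (G x) (G x) u v w z) y := by
  have hG := h.continuousAt
  unfold kulkarniNomizu
  fun_prop

variable [FiniteDimensional ℝ E]

theorem isBivectorForm_curvature4 (h : MetricNear G y) : IsBivectorForm (curvature4 G y) :=
  isBivectorForm_of_isLinearMap
    (fun v w z => (((G y).flip w).toLinearMap ∘ₗ ricciEnd G y v z).isLinear)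
    (fun u v w z => by rw [curvature4, curvature_antisymm]; simp [curvature4])
    (fun u v z => ⟨fun w w' => by simp [curvature4], fun c w => by simp [curvature4]⟩)
    h.curvature4_antisymm

theorem isBivectorForm_riemPencil (h : MetricNear G y) (t a b : ℝ) :
    IsBivectorForm (riemPencil G y t a b) := by
  have hKN := isBivectorForm_kulkarniNomizu_self h.symm.self_of_nhds h.pos.self_of_nhds
  obtain ⟨Q, hQ⟩ := (hKN.const_mul ((a + b * scal G y) / 2)).add
    (h.isBivectorForm_curvature4.const_mul (-(2 * b * t)))
  refine ⟨Q, hQ ▸ ?_⟩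
  ext u v w z
  simp only [riemPencil, riemTensor]
  ring

theorem continuousAt_curvature (h : MetricNear G y) (u v w : E) :
    ContinuousAt (fun x => curvature G x u v w) y := by
  have hΓ : ContinuousAt (christoffel G) y := h.contDiffAt_christoffel.continuousAt
  have hDΓ : ContinuousAt (fderiv ℝ (christoffel G)) y :=
    (h.contDiffAt_christoffel.fderiv_right (m := ∞) (by simp)).continuousAt
  simp only [curvature_apply]
  fun_prop

theorem continuousAt_curvature4 (h : MetricNear G y) (u v w z : E) :
    ContinuousAt (fun x => curvature4 G x u v w z) y :=
  (h.continuousAt.clm_apply (h.continuousAt_curvature u v z)).clm_apply continuousAt_const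

theorem continuousAt_ricci (h : MetricNear G y) (v w : E) :
    ContinuousAt (fun x => ricci G x v w) y := by
  simp only [ricci_apply]
  exact continuousAt_trace fun u => h.continuousAt_curvature u v w

theorem continuousAt_inverse (h : MetricNear G y) : ContinuousAt (fun x => (G x).inverse) y := by
  obtain ⟨e, he⟩ := h.isInvertible
  exact ContinuousAt.comp (g := ContinuousLinearMap.inverse)
    (he ▸ (contDiffAt_map_inverse (𝕜 := ℝ) (n := 0) e).continuousAt) h.continuousAt

theorem continuousAt_scal (h : MetricNear G y) : ContinuousAt (scal G) y := by
  simp only [funext (scal_eq_trace_ricciSharp G)]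
  refine continuousAt_trace fun v => h.continuousAt_inverse.clm_apply ?_
  exact continuousAt_clm_apply.2 fun w => h.continuousAt_ricci v w

theorem continuousAt_riemTensor (h : MetricNear G y) (t : ℝ) (u v w z : E) :
    ContinuousAt (fun x => riemTensor G x t u v w z) y :=
  (h.continuousAt_scal.mul ((h.continuousAt_kulkarniNomizu u v w z).div_const 2)).sub
    ((h.continuousAt_curvature4 u v w z).const_mul (2 * t))

theorem continuousAt_riemPencil (h : MetricNear G y) (t a b : ℝ) (u v w z : E) :
    ContinuousAt (fun x : (ℝ × ℝ) × E => riemPencil G x.2 t x.1.1 x.1.2 u v w z) ((a, b), y) := by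
  have hKN : ContinuousAt (fun x : (ℝ × ℝ) × E => kulkarniNomizu (G x.2) (G x.2) u v w z)
      ((a, b), y) :=
    ContinuousAt.comp (g := fun x => kulkarniNomizu (G x) (G x) u v w z)
      (h.continuousAt_kulkarniNomizu u v w z) continuousAt_snd
  have hT : ContinuousAt (fun x : (ℝ × ℝ) × E => riemTensor G x.2 t u v w z) ((a, b), y) :=
    ContinuousAt.comp (g := fun x => riemTensor G x t u v w z)
      (h.continuousAt_riemTensor t u v w z) continuousAt_snd
  exact (continuousAt_fst.fst.mul (hKN.div_const 2)).add (continuousAt_fst.snd.mul hT)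

end MetricNear

theorem IsometryNear.posDefOnBivectors_riemPencil [FiniteDimensional ℝ E]
    {G' : E → E →L[ℝ] E →L[ℝ] ℝ} {φ : E → E} (h : IsometryNear G' G φ y) {t a b : ℝ}
    (hpos : PosDefOnBivectors (riemPencil G (φ y) t a b)) :
    PosDefOnBivectors (riemPencil G' y t a b) := by
  obtain ⟨e, he⟩ := h.exists_equiv
  have he' : ∀ u, fderiv ℝ φ y u = e u := fun u => (LinearMap.congr_fun he u).symm
  convert hpos.comp_equiv e using 5
  simp only [h.riemPencil_apply, he']

end CurvatureContinuity

section Charts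

open Bundle

variable {E : Type*} [NormedAddCommGroup E] [NormedSpace ℝ E]
  {H : Type*} [TopologicalSpace H] {I : ModelWithCorners ℝ E H}
  {M : Type*} [TopologicalSpace M] [ChartedSpace H M]

/-- A field of bilinear forms on `M` in the preferred chart at `p`: its pullback by the inverse
chart. -/
def formInChart (B : ∀ x : M, TangentSpace I x →L[ℝ] TangentSpace I x →L[ℝ] ℝ) (p : M) (y : E) :
    E →L[ℝ] E →L[ℝ] ℝ :=
  let A : E →L[ℝ] E := mfderiv 𝓘(ℝ, E) I (extChartAt I p).symm y
  let C : E →L[ℝ] E →L[ℝ] ℝ := B ((extChartAt I p).symm y)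
  C.bilinearComp A A

theorem formInChart_apply (B : ∀ x : M, TangentSpace I x →L[ℝ] TangentSpace I x →L[ℝ] ℝ) (p : M)
    (y u v : E) : formInChart B p y u v = B ((extChartAt I p).symm y)
      (mfderiv 𝓘(ℝ, E) I (extChartAt I p).symm y u)
      (mfderiv 𝓘(ℝ, E) I (extChartAt I p).symm y v) := rfl

theorem form_apply_congr (B : ∀ x : M, TangentSpace I x →L[ℝ] TangentSpace I x →L[ℝ] ℝ) {x x' : M}
    (hx : x = x') (u v : E) :
    (B x : E →L[ℝ] E →L[ℝ] ℝ) u v = (B x' : E →L[ℝ] E →L[ℝ] ℝ) u v := by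
  rw [hx]

/-- The transition map between the preferred charts at `q` and at `p`. -/
def transition (I : ModelWithCorners ℝ E H) (q p : M) : E → E :=
  extChartAt I p ∘ (extChartAt I q).symm

theorem transition_extChartAt_self (q p : M) :
    transition I q p (extChartAt I q q) = extChartAt I p q := by
  rw [transition, Function.comp_apply, extChartAt_to_inv]

variable [I.Boundaryless] [IsManifold I ∞ M]

theorem inCoordinates_eq_formInChart
    (B : ∀ x : M, TangentSpace I x →L[ℝ] TangentSpace I x →L[ℝ] ℝ) {p x : M}
    (hx : x ∈ (extChartAt I p).source) :
    ContinuousLinearMap.inCoordinates E (TangentSpace I) (E →L[ℝ] ℝ)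
      (fun x : M => TangentSpace I x →L[ℝ] ℝ) p x p x (B x) =
      formInChart B p (extChartAt I p x) := by
  have hx' : x ∈ (chartAt H p).source := by rwa [extChartAt_source] at hx
  have hsymm : ∀ w : E, (trivializationAt E (TangentSpace I) p).symm x w =
      (mfderiv 𝓘(ℝ, E) I (extChartAt I p).symm (extChartAt I p x) : E →L[ℝ] E) w := fun w => by
    have hsymmL := TangentBundle.symmL_trivializationAt (𝕜 := ℝ) (I := I) hx'
    rw [I.range_eq_univ, mfderivWithin_univ] at hsymmL
    exact ((Trivialization.symmL_apply _ (by simpa using hx') w).symm).trans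
      (congrArg (fun L : E →L[ℝ] E => L w) hsymmL)
  ext u v
  refine (inCoordinates_apply_eq₂ (𝕜 := ℝ) (E₁ := TangentSpace I) (E₂ := TangentSpace I)
    (E₃ := Bundle.Trivial M ℝ) (by simpa using hx') (by simpa using hx') (by simp)).trans ?_
  rw [formInChart_apply, hsymm, hsymm]
  simpa using form_apply_congr B ((extChartAt I p).left_inv hx).symm _ _

set_option synthInstance.maxHeartbeats 200000 in
-- The instances on `T*M ⊗ T*M` are found by unfolding two nested `Hom` bundles.
theorem contMDiffOn_section_iff (B : ∀ x : M, TangentSpace I x →L[ℝ] TangentSpace I x →L[ℝ] ℝ)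
    (p : M) :
    ContMDiffOn I (I.prod 𝓘(ℝ, E →L[ℝ] E →L[ℝ] ℝ)) ∞
      (fun x => TotalSpace.mk' (E →L[ℝ] E →L[ℝ] ℝ) x (B x)) (extChartAt I p).source ↔
    ContDiffOn ℝ ∞ (formInChart B p) (extChartAt I p).target := by
  let e := trivializationAt (E →L[ℝ] E →L[ℝ] ℝ)
    (fun x : M => TangentSpace I x →L[ℝ] TangentSpace I x →L[ℝ] ℝ) p
  have hbase : e.baseSet = (extChartAt I p).source := by
    rw [extChartAt_source]
    simp [e]
  have hcoord : ∀ x ∈ (extChartAt I p).source,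
      (e ⟨x, B x⟩).2 = formInChart B p (extChartAt I p x) :=
    fun x hx => inCoordinates_eq_formInChart B hx
  have htriv := Trivialization.contMDiffOn_section_baseSet_iff (IB := I) (n := ∞)
    (F := E →L[ℝ] E →L[ℝ] ℝ) (e := e) (s := B)
  rw [hbase] at htriv
  rw [htriv, contMDiffOn_congr hcoord, ← contMDiffOn_iff_contDiffOn]
  constructor <;> intro hB
  · refine (hB.comp (contMDiffOn_extChartAt_symm p) (extChartAt I p).symm.mapsTo).congr ?_
    intro y hy
    rw [Function.comp_apply, (extChartAt I p).right_inv hy]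
  · exact hB.comp (extChartAt_source (I := I) p ▸ contMDiffOn_extChartAt) (extChartAt I p).mapsTo

theorem mfderiv_extChartAt_symm_injective {p : M} {z : E} (hz : z ∈ (extChartAt I p).target) :
    Function.Injective (mfderiv 𝓘(ℝ, E) I (extChartAt I p).symm z : E →L[ℝ] E) := by
  have hinv := isInvertible_mfderivWithin_extChartAt_symm (I := I) hz
  rw [I.range_eq_univ, mfderivWithin_univ] at hinv
  exact hinv.injective

theorem mdifferentiableAt_extChartAt_symm {p : M} {z : E} (hz : z ∈ (extChartAt I p).target) :
    MDifferentiableAt 𝓘(ℝ, E) I (extChartAt I p).symm z :=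
  ((contMDiffOn_extChartAt_symm (n := ∞) p).contMDiffAt
    ((isOpen_extChartAt_target p).mem_nhds hz)).mdifferentiableAt (by simp)

theorem metricNear_metricInChart (g : Metric I M) {p : M} {z : E}
    (hz : z ∈ (extChartAt I p).target) : MetricNear (metricInChart g p) z where
  contDiffAt := by
    have hg : ContDiffOn ℝ ∞ (metricInChart g p) (extChartAt I p).target :=
      (contMDiffOn_section_iff g.inner p).1 g.contMDiff.contMDiffOn
    filter_upwards [eventually_mem_nhds_iff.2 ((isOpen_extChartAt_target p).mem_nhds hz)]
      with x hx using hg.contDiffAt hx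
  symm := by
    filter_upwards with x u v
    rw [metricInChart_apply, metricInChart_apply]
    exact g.symm _ _ _
  pos := by
    filter_upwards [(isOpen_extChartAt_target p).mem_nhds hz] with x hx v hv
    rw [metricInChart_apply]
    refine g.pos _ _ fun himage => hv ?_
    exact mfderiv_extChartAt_symm_injective hx (himage.trans (map_zero _).symm)

section ChangeOfCharts

variable {p q : M} {z : E}

theorem contDiffAt_transition (hz : z ∈ (extChartAt I q).target)
    (hz' : (extChartAt I q).symm z ∈ (extChartAt I p).source) :
    ContDiffAt ℝ ∞ (transition I q p) z := by
  rw [← contMDiffAt_iff_contDiffAt]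
  refine ContMDiffAt.comp z (contMDiffAt_extChartAt' (extChartAt_source I p ▸ hz')) ?_
  exact (contMDiffOn_extChartAt_symm q).contMDiffAt ((isOpen_extChartAt_target q).mem_nhds hz)

theorem mfderiv_extChartAt_symm_transition (hz : z ∈ (extChartAt I q).target)
    (hz' : (extChartAt I q).symm z ∈ (extChartAt I p).source) (v : E) :
    (mfderiv 𝓘(ℝ, E) I (extChartAt I q).symm z : E →L[ℝ] E) v =
      (mfderiv 𝓘(ℝ, E) I (extChartAt I p).symm (transition I q p z) : E →L[ℝ] E)
        (fderiv ℝ (transition I q p) z v) := by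
  have hcomp : (extChartAt I q).symm =ᶠ[𝓝 z] (extChartAt I p).symm ∘ transition I q p := by
    have hsource := ((continuousOn_extChartAt_symm q).continuousAt
      ((isOpen_extChartAt_target q).mem_nhds hz)).eventually
      ((isOpen_extChartAt_source (I := I) p).mem_nhds hz')
    filter_upwards [hsource] with x hx using ((extChartAt I p).left_inv hx).symm
  rw [hcomp.mfderiv_eq, mfderiv_comp z
    (mdifferentiableAt_extChartAt_symm ((extChartAt I p).map_source hz'))
    ((contDiffAt_transition hz hz').differentiableAt (by simp)).mdifferentiableAt,
    mfderiv_eq_fderiv]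
  rfl

theorem isometryNear_transition (g : Metric I M) (hq : q ∈ (extChartAt I p).source) :
    IsometryNear (metricInChart g q) (metricInChart g p) (transition I q p)
      (extChartAt I q q) := by
  have hdomain : ∀ᶠ z in 𝓝 (extChartAt I q q),
      z ∈ (extChartAt I q).target ∧ (extChartAt I q).symm z ∈ (extChartAt I p).source := by
    refine Filter.Eventually.and (extChartAt_target_mem_nhds (I := I) q) ?_
    refine (continuousAt_extChartAt_symm q).eventually ?_
    rw [extChartAt_to_inv]
    exact (isOpen_extChartAt_source p).mem_nhds hq
  have hp := hdomain.self_of_nhds.2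
  refine ⟨metricNear_metricInChart g (mem_extChartAt_target q),
    metricNear_metricInChart g ((extChartAt I p).map_source hp), ?_, ?_⟩
  · filter_upwards [hdomain] with z hz using contDiffAt_transition hz.1 hz.2
  · filter_upwards [hdomain] with z hz u v
    rw [metricInChart_apply, metricInChart_apply]
    refine (form_apply_congr g.inner ((extChartAt I p).left_inv hz.2).symm _ _).trans ?_
    exact congrArg₂ (fun a b : E => (g.inner _ : E →L[ℝ] E →L[ℝ] ℝ) a b)
      (mfderiv_extChartAt_symm_transition hz.1 hz.2 u)
      (mfderiv_extChartAt_symm_transition hz.1 hz.2 v)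

end ChangeOfCharts

end Charts

section PositiveForms

variable {E : Type*} [NormedAddCommGroup E] [NormedSpace ℝ E]

/-- The cone of positive definite symmetric bilinear forms, in which the values of a Riemannian
metric lie. -/
def posDefForms (E : Type*) [NormedAddCommGroup E] [NormedSpace ℝ E] : Set (E →L[ℝ] E →L[ℝ] ℝ) :=
  {B | (∀ u v, B u v = B v u) ∧ ∀ v, v ≠ 0 → 0 < B v v}

theorem convex_posDefForms : Convex ℝ (posDefForms E) := by
  intro B hB C hC a b ha hb hab
  refine ⟨fun u v => ?_, fun v hv => ?_⟩
  · simp only [add_apply, smul_apply, hB.1 u v, hC.1 u v]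
  · exact convex_Ioi (0 : ℝ) (hB.2 v hv) (hC.2 v hv) ha hb hab

theorem bilinearComp_mem_posDefForms {F : Type*} [NormedAddCommGroup F] [NormedSpace ℝ F]
    {B : F →L[ℝ] F →L[ℝ] ℝ} (hB : B ∈ posDefForms F) {L : E →L[ℝ] F}
    (hL : Function.Injective L) : B.bilinearComp L L ∈ posDefForms E :=
  ⟨fun _ _ => hB.1 _ _, fun _ hv => hB.2 _ ((map_ne_zero_iff L hL).2 hv)⟩

variable [FiniteDimensional ℝ E]

theorem posDefForms_nonempty : (posDefForms E).Nonempty := by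
  let e : E ≃L[ℝ] EuclideanSpace ℝ (Fin (Module.finrank ℝ E)) := toEuclidean
  have hinner : innerSL ℝ ∈ posDefForms (EuclideanSpace ℝ (Fin (Module.finrank ℝ E))) :=
    ⟨fun u v => real_inner_comm v u, fun _ => real_inner_self_pos.2⟩
  exact ⟨_, bilinearComp_mem_posDefForms hinner (L := e.toContinuousLinearMap) e.injective⟩

theorem isCoercive_of_pos {B : E →L[ℝ] E →L[ℝ] ℝ} (hB : ∀ v, v ≠ 0 → 0 < B v v) :
    IsCoercive B := by
  have : ProperSpace E := FiniteDimensional.proper ℝ E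
  obtain ⟨c, hc, hcB⟩ := (isCompact_sphere (0 : E) 1).exists_forall_le' (f := fun v => B v v)
    (a := 0) (B.continuous.clm_apply continuous_id).continuousOn
    (fun v hv => hB v (by rintro rfl; simp at hv))
  refine ⟨c, hc, fun v => ?_⟩
  rcases eq_or_ne v 0 with rfl | hv
  · simp
  have hnorm : ‖v‖ ≠ 0 := norm_ne_zero_iff.2 hv
  have hunit := hcB (‖v‖⁻¹ • v) (by simp [norm_smul, hnorm])
  calc c * ‖v‖ * ‖v‖ ≤ B (‖v‖⁻¹ • v) (‖v‖⁻¹ • v) * ‖v‖ * ‖v‖ := by gcongr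
    _ = B v v := by
      simp only [map_smul, smul_apply, smul_eq_mul]
      field_simp

theorem isVonNBounded_of_pos {B : E →L[ℝ] E →L[ℝ] ℝ} (hB : ∀ v, v ≠ 0 → 0 < B v v) :
    Bornology.IsVonNBounded ℝ {v : E | B v v < 1} := by
  obtain ⟨c, hc, hcB⟩ := isCoercive_of_pos hB
  rw [NormedSpace.isVonNBounded_iff, isBounded_iff_forall_norm_le]
  refine ⟨Real.sqrt c⁻¹, fun v hv => Real.le_sqrt_of_sq_le ?_⟩
  rw [← one_div, le_div_iff₀ hc]
  calc ‖v‖ ^ 2 * c = c * ‖v‖ * ‖v‖ := by ring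
    _ ≤ B v v := hcB v
    _ ≤ 1 := le_of_lt hv

end PositiveForms

section MetricExistence

open Bundle

variable {E : Type*} [NormedAddCommGroup E] [NormedSpace ℝ E]
  {H : Type*} [TopologicalSpace H] (I : ModelWithCorners ℝ E H) [I.Boundaryless]
  (M : Type*) [TopologicalSpace M] [ChartedSpace H M] [IsManifold I ∞ M]

variable {M} in
/-- The field of bilinear forms that is constant, with value `B`, in the preferred chart at `p`. -/
def constantInChart (B : E →L[ℝ] E →L[ℝ] ℝ) (p x : M) :
    TangentSpace I x →L[ℝ] TangentSpace I x →L[ℝ] ℝ :=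
  let A : E →L[ℝ] E := mfderiv I 𝓘(ℝ, E) (extChartAt I p) x
  let C : E →L[ℝ] E →L[ℝ] ℝ := B.bilinearComp A A
  C

variable {M} in
theorem contMDiffOn_constantInChart (B : E →L[ℝ] E →L[ℝ] ℝ) (p : M) :
    ContMDiffOn I (I.prod 𝓘(ℝ, E →L[ℝ] E →L[ℝ] ℝ)) ∞
      (fun x => TotalSpace.mk' (E →L[ℝ] E →L[ℝ] ℝ) x (constantInChart I B p x))
      (extChartAt I p).source := by
  refine (contMDiffOn_section_iff _ p).2 ((contDiffOn_const (c := B)).congr fun y hy => ?_)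
  have hinv := mfderiv_extChartAt_comp_mfderivWithin_extChartAt_symm (I := I) hy
  rw [I.range_eq_univ, mfderivWithin_univ] at hinv
  have hinv_apply : ∀ w : E, (mfderiv I 𝓘(ℝ, E) (extChartAt I p) ((extChartAt I p).symm y) :
      E →L[ℝ] E) (mfderiv 𝓘(ℝ, E) I (extChartAt I p).symm y w) = w := fun w =>
    congrArg (fun L : E →L[ℝ] E => L w) hinv
  ext u v
  exact congrArg₂ (fun a b => B a b) (hinv_apply u) (hinv_apply v)

set_option synthInstance.maxHeartbeats 200000 in
-- The instances on `T*M ⊗ T*M` are found by unfolding two nested `Hom` bundles.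
theorem nonempty_metric [FiniteDimensional ℝ E] [T2Space M] [SigmaCompactSpace M] :
    Nonempty (Metric I M) := by
  obtain ⟨B₀, hB₀⟩ := posDefForms_nonempty (E := E)
  have hlocal (p x : M) (hx : x ∈ (extChartAt I p).source) :
      constantInChart I B₀ p x ∈ posDefForms E :=
    bilinearComp_mem_posDefForms hB₀ (isInvertible_mfderiv_extChartAt (I := I) hx).injective
  obtain ⟨s, hs⟩ := exists_contMDiffSection_forall_mem_convex_of_local (I := I) (n := ⊤)
    (F_fiber := E →L[ℝ] E →L[ℝ] ℝ)
    (V := fun x : M => TangentSpace I x →L[ℝ] TangentSpace I x →L[ℝ] ℝ)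
    (t := fun _ => posDefForms E) (fun _ => by exact convex_posDefForms (E := E)) (fun p => by
      exact ⟨_, extChartAt_source_mem_nhds (I := I) p, constantInChart I B₀ p,
        contMDiffOn_constantInChart I B₀ p, hlocal p⟩)
  exact ⟨⟨fun x => s x, fun x => (hs x).1, fun x => (hs x).2,
    fun x => isVonNBounded_of_pos (E := E) (hs x).2, s.contMDiff⟩⟩

end MetricExistence

section MetricScaling

variable {E : Type*} [NormedAddCommGroup E] [NormedSpace ℝ E] [FiniteDimensional ℝ E]
  {H : Type*} [TopologicalSpace H] {I : ModelWithCorners ℝ E H}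
  {M : Type*} [TopologicalSpace M] [ChartedSpace H M] [IsManifold I ∞ M] {c : ℝ}

/-- The homothetic metric `c g`. -/
def scaledMetric (hc : 0 < c) (g : Metric I M) : Metric I M where
  inner := c • g.inner
  symm p u v := congrArg (c * ·) (g.symm p u v)
  pos p v hv := mul_pos hc (g.pos p v hv)
  isVonNBounded p :=
    isVonNBounded_of_pos (E := E) (B := c • g.inner p) fun v hv => mul_pos hc (g.pos p v hv)
  contMDiff := g.contMDiff.const_smul_section

theorem metricInChart_scaledMetric (hc : 0 < c) (g : Metric I M) (p : M) :
    metricInChart (scaledMetric hc g) p = c • metricInChart g p := rfl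

theorem scalAt_scaledMetric (hc : 0 < c) (g : Metric I M) (p : M) :
    scalAt (scaledMetric hc g) p = c⁻¹ * scalAt g p := by
  rw [scalAt, metricInChart_scaledMetric, scal_smul hc.ne', scalAt]

end MetricScaling

section MetricProduct

variable {E₁ : Type*} [NormedAddCommGroup E₁] [NormedSpace ℝ E₁]
  {H₁ : Type*} [TopologicalSpace H₁] {I₁ : ModelWithCorners ℝ E₁ H₁} [I₁.Boundaryless]
  {E₂ : Type*} [NormedAddCommGroup E₂] [NormedSpace ℝ E₂]
  {H₂ : Type*} [TopologicalSpace H₂] {I₂ : ModelWithCorners ℝ E₂ H₂} [I₂.Boundaryless]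
  {M₁ : Type*} [TopologicalSpace M₁] [ChartedSpace H₁ M₁] [IsManifold I₁ ∞ M₁]
  {M₂ : Type*} [TopologicalSpace M₂] [ChartedSpace H₂ M₂] [IsManifold I₂ ∞ M₂]

theorem mfderiv_extChartAt_symm_prod {p : M₁ × M₂} {y : E₁ × E₂}
    (hy : y ∈ (extChartAt (I₁.prod I₂) p).target) (v : E₁ × E₂) :
    (mfderiv 𝓘(ℝ, E₁ × E₂) (I₁.prod I₂) (extChartAt (I₁.prod I₂) p).symm y :
      E₁ × E₂ →L[ℝ] E₁ × E₂) v =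
    ((mfderiv 𝓘(ℝ, E₁) I₁ (extChartAt I₁ p.1).symm y.1 : E₁ →L[ℝ] E₁) v.1,
      (mfderiv 𝓘(ℝ, E₂) I₂ (extChartAt I₂ p.2).symm y.2 : E₂ →L[ℝ] E₂) v.2) := by
  rw [extChartAt_prod] at hy ⊢
  have hsymm₁ := mdifferentiableAt_extChartAt_symm (I := I₁) hy.1
  have hsymm₂ := mdifferentiableAt_extChartAt_symm (I := I₂) hy.2
  have hfst : MDifferentiableAt 𝓘(ℝ, E₁ × E₂) 𝓘(ℝ, E₁) (Prod.fst : E₁ × E₂ → E₁) y :=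
    differentiableAt_fst.mdifferentiableAt
  have hsnd : MDifferentiableAt 𝓘(ℝ, E₁ × E₂) 𝓘(ℝ, E₂) (Prod.snd : E₁ × E₂ → E₂) y :=
    differentiableAt_snd.mdifferentiableAt
  have hprod := mfderiv_prodMk (hsymm₁.comp y hfst) (hsymm₂.comp y hsnd)
  rw [mfderiv_comp y hsymm₁ hfst, mfderiv_comp y hsymm₂ hsnd, mfderiv_eq_fderiv,
    mfderiv_eq_fderiv, fderiv_fst, fderiv_snd] at hprod
  exact congrArg (fun L : E₁ × E₂ →L[ℝ] E₁ × E₂ => L v) hprod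

/-- The field of bilinear forms of the product metric `g₁ + g₂` on `M₁ × M₂`. -/
def prodInner (g₁ : Metric I₁ M₁) (g₂ : Metric I₂ M₂) (p : M₁ × M₂) :
    TangentSpace (I₁.prod I₂) p →L[ℝ] TangentSpace (I₁.prod I₂) p →L[ℝ] ℝ :=
  let B : E₁ × E₂ →L[ℝ] E₁ × E₂ →L[ℝ] ℝ :=
    prodForm (E₁ := E₁) (E₂ := E₂) (g₁.inner p.1) (g₂.inner p.2)
  B

theorem formInChart_prodInner (g₁ : Metric I₁ M₁) (g₂ : Metric I₂ M₂) {p : M₁ × M₂}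
    {y : E₁ × E₂} (hy : y ∈ (extChartAt (I₁.prod I₂) p).target) :
    formInChart (prodInner g₁ g₂) p y =
      prodMetric (metricInChart g₁ p.1) (metricInChart g₂ p.2) y := by
  apply ContinuousLinearMap.ext; intro u
  apply ContinuousLinearMap.ext; intro v
  rw [formInChart_apply, prodMetric, prodForm_apply, metricInChart_apply, metricInChart_apply]
  refine (congrArg₂ (fun u v : E₁ × E₂ =>
    (prodInner g₁ g₂ ((extChartAt (I₁.prod I₂) p).symm y) :
      E₁ × E₂ →L[ℝ] E₁ × E₂ →L[ℝ] ℝ) u v)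
    (mfderiv_extChartAt_symm_prod hy u) (mfderiv_extChartAt_symm_prod hy v)).trans ?_
  refine (prodForm_apply _ _ _ _).trans ?_
  rw [extChartAt_prod]
  rfl

theorem contDiffOn_formInChart_prodInner (g₁ : Metric I₁ M₁) (g₂ : Metric I₂ M₂) (p : M₁ × M₂) :
    ContDiffOn ℝ ∞ (formInChart (prodInner g₁ g₂) p) (extChartAt (I₁.prod I₂) p).target := by
  intro y hy
  have hy' := hy
  rw [extChartAt_prod] at hy'
  have hprod := ((metricNear_metricInChart g₁ hy'.1).prod
    (metricNear_metricInChart g₂ hy'.2)).contDiffAt.self_of_nhds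
  exact hprod.contDiffWithinAt.congr (fun z hz => formInChart_prodInner g₁ g₂ hz)
    (formInChart_prodInner g₁ g₂ hy)

variable [FiniteDimensional ℝ E₁] [FiniteDimensional ℝ E₂]

/-- The product Riemannian metric on a product of manifolds. -/
def productMetric (g₁ : Metric I₁ M₁) (g₂ : Metric I₂ M₂) : Metric (I₁.prod I₂) (M₁ × M₂) where
  inner := prodInner g₁ g₂
  symm p _ _ := (prodForm_apply _ _ _ _).trans <|
    (congrArg₂ (fun a b => a + b) (g₁.symm p.1 _ _) (g₂.symm p.2 _ _)).trans
      (prodForm_apply (E₁ := E₁) (E₂ := E₂) _ _ _ _).symm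
  pos p := prodForm_pos (E₁ := E₁) (E₂ := E₂) (g₁.pos p.1) (g₂.pos p.2)
  isVonNBounded p := isVonNBounded_of_pos (E := E₁ × E₂) (B := prodInner g₁ g₂ p)
    (prodForm_pos (E₁ := E₁) (E₂ := E₂) (g₁.pos p.1) (g₂.pos p.2))
  contMDiff p := ((contMDiffOn_section_iff (prodInner g₁ g₂) p).2
    (contDiffOn_formInChart_prodInner g₁ g₂ p)).contMDiffAt
      (extChartAt_source_mem_nhds (I := I₁.prod I₂) p)

variable (g₁ : Metric I₁ M₁) (g₂ : Metric I₂ M₂)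

theorem metricInChart_productMetric (p : M₁ × M₂) :
    metricInChart (productMetric g₁ g₂) p =ᶠ[𝓝 (extChartAt (I₁.prod I₂) p p)]
      prodMetric (metricInChart g₁ p.1) (metricInChart g₂ p.2) := by
  filter_upwards [extChartAt_target_mem_nhds (I := I₁.prod I₂) p] with y hy
  exact formInChart_prodInner g₁ g₂ hy

theorem scalAt_productMetric (p : M₁ × M₂) :
    scalAt (productMetric g₁ g₂) p = scalAt g₁ p.1 + scalAt g₂ p.2 := by
  rw [scalAt, scal_congr (metricInChart_productMetric g₁ g₂ p), extChartAt_prod]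
  exact scal_prodMetric (y := (extChartAt I₁ p.1 p.1, extChartAt I₂ p.2 p.2))
    (metricNear_metricInChart g₁ (mem_extChartAt_target p.1))
    (metricNear_metricInChart g₂ (mem_extChartAt_target p.2))

end MetricProduct

section Pencil

variable {E : Type*} [NormedAddCommGroup E] [NormedSpace ℝ E] [FiniteDimensional ℝ E]
  {H : Type*} [TopologicalSpace H] {I : ModelWithCorners ℝ E H}
  {M : Type*} [TopologicalSpace M] [ChartedSpace H M] [IsManifold I ∞ M]

/-- The tensor `a g² / 2 + b Riem_t(g)` at `p`, in the chart at `p`. -/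
def riemPencilAt (g : Metric I M) (t a b : ℝ) (p : M) : E → E → E → E → ℝ :=
  riemPencil (metricInChart g p) (extChartAt I p p) t a b

theorem riemPencilAt_zero_one (g : Metric I M) (t : ℝ) (p : M) :
    riemPencilAt g t 0 1 p = riemTensorAt g t p := by
  ext u v w z
  simp [riemPencilAt, riemPencil, riemTensorAt]

theorem posDefOnBivectors_riemPencilAt_scaledMetric {g : Metric I M} {c t a b : ℝ} {p : M}
    (hc : 0 < c) (hpos : PosDefOnBivectors (riemPencilAt g t a (c⁻¹ * b) p)) :
    PosDefOnBivectors (riemPencilAt (scaledMetric hc g) t a b p) := by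
  convert hpos.const_mul (pow_pos hc 2) using 5 with u v w z
  rw [riemPencilAt, metricInChart_scaledMetric, riemPencil_smul hc.ne', riemPencilAt, riemPencil,
    riemPencil]
  field_simp

variable [I.Boundaryless]

theorem posDefOnBivectors_riemPencilAt_of_pos (g : Metric I M) (t : ℝ) {a : ℝ} (ha : 0 < a)
    (p : M) : PosDefOnBivectors (riemPencilAt g t a 0 p) := by
  have hg := metricNear_metricInChart g (mem_extChartAt_target (I := I) p)
  convert (posDefOnBivectors_kulkarniNomizu_self hg.symm.self_of_nhds
    hg.pos.self_of_nhds).const_mul (half_pos ha) using 5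
  rw [riemPencilAt, riemPencil]
  ring

theorem scalAt_eq_scal_metricInChart (g : Metric I M) {p q : M}
    (hq : q ∈ (extChartAt I p).source) :
    scalAt g q = scal (metricInChart g p) (extChartAt I p q) := by
  rw [scalAt, (isometryNear_transition g hq).scal_eq, transition_extChartAt_self]

theorem continuous_scalAt (g : Metric I M) : Continuous (scalAt g) := by
  refine continuous_iff_continuousAt.2 fun p => ?_
  have hscal : ContinuousAt (fun q => scal (metricInChart g p) (extChartAt I p q)) p :=
    ContinuousAt.comp (f := extChartAt I p)
      (metricNear_metricInChart g (mem_extChartAt_target p)).continuousAt_scal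
      (continuousAt_extChartAt p)
  refine hscal.congr ?_
  filter_upwards [extChartAt_source_mem_nhds (I := I) p] with q hq
  exact (scalAt_eq_scal_metricInChart g hq).symm

theorem isOpen_setOf_posDefOnBivectors_riemPencilAt (g : Metric I M) (t : ℝ) :
    IsOpen {x : (ℝ × ℝ) × M | PosDefOnBivectors (riemPencilAt g t x.1.1 x.1.2 x.2)} := by
  refine isOpen_iff_eventually.2 ?_
  rintro ⟨⟨a, b⟩, p⟩ hpos
  have hg := metricNear_metricInChart g (mem_extChartAt_target (I := I) p)
  have hchart : ContinuousAt (fun x : (ℝ × ℝ) × M => extChartAt I p x.2) ((a, b), p) :=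
    ContinuousAt.comp (f := Prod.snd) (continuousAt_extChartAt (I := I) p) continuousAt_snd
  have hpos_chart : ∀ᶠ x : (ℝ × ℝ) × M in 𝓝 ((a, b), p), PosDefOnBivectors
      (riemPencil (metricInChart g p) (extChartAt I p x.2) t x.1.1 x.1.2) := by
    refine PosDefOnBivectors.eventually (T := fun x : (ℝ × ℝ) × M =>
      riemPencil (metricInChart g p) (extChartAt I p x.2) t x.1.1 x.1.2) ?_ ?_ hpos
    · filter_upwards [hchart.eventually hg.eventually] with x hx
      exact hx.isBivectorForm_riemPencil t _ _
    · intro u v w z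
      exact ContinuousAt.comp (f := fun x : (ℝ × ℝ) × M => (x.1, extChartAt I p x.2))
        (hg.continuousAt_riemPencil t a b u v w z) (continuousAt_fst.prodMk hchart)
  filter_upwards [hpos_chart,
    continuousAt_snd.eventually (extChartAt_source_mem_nhds (I := I) p)] with x hx hsource
  refine (isometryNear_transition g hsource).posDefOnBivectors_riemPencil ?_
  rwa [transition_extChartAt_self]

end Pencil

section ProductPositivity

variable {E₁ : Type*} [NormedAddCommGroup E₁] [NormedSpace ℝ E₁] [FiniteDimensional ℝ E₁]
  {H₁ : Type*} [TopologicalSpace H₁] {I₁ : ModelWithCorners ℝ E₁ H₁}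
  {E₂ : Type*} [NormedAddCommGroup E₂] [NormedSpace ℝ E₂] [FiniteDimensional ℝ E₂]
  {H₂ : Type*} [TopologicalSpace H₂] {I₂ : ModelWithCorners ℝ E₂ H₂}
  {M₁ : Type*} [TopologicalSpace M₁] [ChartedSpace H₁ M₁] [IsManifold I₁ ∞ M₁]
  {M₂ : Type*} [TopologicalSpace M₂] [ChartedSpace H₂ M₂] [IsManifold I₂ ∞ M₂]
  {g₁ : Metric I₁ M₁} {g₂ : Metric I₂ M₂} {t : ℝ}

/-- Positivity of the three blocks of `Riem_t` of the product metric on `M₁ × M₂`, according to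
the splitting `Λ²(E₁ × E₂) = Λ²E₁ ⊕ (E₁ ⊗ E₂) ⊕ Λ²E₂`. -/
def BlocksPos (g₁ : Metric I₁ M₁) (g₂ : Metric I₂ M₂) (t : ℝ) : Prop :=
  ∀ p q, 0 < scalAt g₁ p + scalAt g₂ q ∧
    PosDefOnBivectors (riemPencilAt g₁ t (scalAt g₂ q) 1 p) ∧
    PosDefOnBivectors (riemPencilAt g₂ t (scalAt g₁ p) 1 q)

theorem BlocksPos.symm (h : BlocksPos g₁ g₂ t) : BlocksPos g₂ g₁ t := fun q p =>
  ⟨add_comm (scalAt g₁ p) _ ▸ (h p q).1, (h p q).2.2, (h p q).2.1⟩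

variable [I₁.Boundaryless] [I₂.Boundaryless]

theorem BlocksPos.scalAt_productMetric_pos (h : BlocksPos g₁ g₂ t) (p : M₁ × M₂) :
    0 < scalAt (productMetric g₁ g₂) p :=
  scalAt_productMetric g₁ g₂ p ▸ (h p.1 p.2).1

theorem BlocksPos.riemTensorPos_productMetric (h : BlocksPos g₁ g₂ t) :
    RiemTensorPos (productMetric g₁ g₂) t := by
  intro p
  obtain ⟨hs, hpos₁, hpos₂⟩ := h p.1 p.2
  have hg₁ := metricNear_metricInChart g₁ (mem_extChartAt_target (I := I₁) p.1)
  have hg₂ := metricNear_metricInChart g₂ (mem_extChartAt_target (I := I₂) p.2)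
  have hblocks := posDefOnBivectors_prod (hg₁.isBivectorForm_riemPencil t (scalAt g₂ p.2) 1) hpos₁
    (hg₂.isBivectorForm_riemPencil t (scalAt g₁ p.1) 1) hpos₂ hg₁.pos.self_of_nhds
    hg₂.symm.self_of_nhds hg₂.pos.self_of_nhds hs
  convert hblocks using 5 with u v w z
  rw [riemTensorAt, riemTensor_congr (metricInChart_productMetric g₁ g₂ p), extChartAt_prod]
  exact riemTensor_prodMetric (y := (extChartAt I₁ p.1 p.1, extChartAt I₂ p.2 p.2)) hg₁ hg₂ t
    u v w z

theorem eventually_blocks_pos [CompactSpace M₁] [CompactSpace M₂] (g₂ : Metric I₂ M₂)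
    (hs : ∀ p, 0 < scalAt g₁ p) (hpos : RiemTensorPos g₁ t) :
    ∀ᶠ δ in 𝓝 (0 : ℝ), ∀ p q, 0 < scalAt g₁ p + δ * scalAt g₂ q ∧
      PosDefOnBivectors (riemPencilAt g₁ t (δ * scalAt g₂ q) 1 p) ∧
      PosDefOnBivectors (riemPencilAt g₂ t (scalAt g₁ p) δ q) := by
  have hs₁ := continuous_scalAt g₁
  have hs₂ := continuous_scalAt g₂
  let P (δ : ℝ) (x : M₁ × M₂) : Prop := 0 < scalAt g₁ x.1 + δ * scalAt g₂ x.2 ∧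
    PosDefOnBivectors (riemPencilAt g₁ t (δ * scalAt g₂ x.2) 1 x.1) ∧
    PosDefOnBivectors (riemPencilAt g₂ t (scalAt g₁ x.1) δ x.2)
  have hopen : IsOpen {x : ℝ × M₁ × M₂ | P x.1 x.2} := by
    have hmixed : IsOpen {x : ℝ × M₁ × M₂ | 0 < scalAt g₁ x.2.1 + x.1 * scalAt g₂ x.2.2} :=
      isOpen_lt continuous_const (by fun_prop)
    have hfirst := (isOpen_setOf_posDefOnBivectors_riemPencilAt g₁ t).preimage
      (f := fun x : ℝ × M₁ × M₂ => ((x.1 * scalAt g₂ x.2.2, 1), x.2.1)) (by fun_prop)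
    have hsecond := (isOpen_setOf_posDefOnBivectors_riemPencilAt g₂ t).preimage
      (f := fun x : ℝ × M₁ × M₂ => ((scalAt g₁ x.2.1, x.1), x.2.2)) (by fun_prop)
    exact hmixed.inter (hfirst.inter hsecond)
  have hzero (x : M₁ × M₂) : P 0 x := by
    simpa [P, riemPencilAt_zero_one] using
      ⟨hs x.1, hpos x.1, posDefOnBivectors_riemPencilAt_of_pos g₂ t (hs x.1) x.2⟩
  have hnear : ∀ᶠ δ in 𝓝 (0 : ℝ), ∀ x ∈ Set.univ, P δ x :=
    isCompact_univ.eventually_forall_of_forall_eventually fun x _ =>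
      hopen.eventually_mem (x := (0, x)) (hzero x)
  filter_upwards [hnear] with δ hδ p q using hδ (p, q) (Set.mem_univ _)

theorem exists_blocksPos [CompactSpace M₁] [CompactSpace M₂] [T2Space M₂]
    (hs : ∀ p, 0 < scalAt g₁ p) (hpos : RiemTensorPos g₁ t) :
    ∃ g₂ : Metric I₂ M₂, BlocksPos g₁ g₂ t := by
  obtain ⟨g⟩ := nonempty_metric I₂ M₂
  obtain ⟨δ, hδ, hδ_pos : 0 < δ⟩ := (((eventually_blocks_pos g hs hpos).filter_mono
    (nhdsWithin_le_nhds (s := Set.Ioi 0))).and self_mem_nhdsWithin).exists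
  refine ⟨scaledMetric (inv_pos.2 hδ_pos) g, fun p q => ?_⟩
  rw [scalAt_scaledMetric, inv_inv]
  obtain ⟨hmixed, hfirst, hsecond⟩ := hδ p q
  refine ⟨hmixed, hfirst, posDefOnBivectors_riemPencilAt_scaledMetric _ ?_⟩
  rwa [inv_inv, mul_one]

end ProductPositivity

section Invariant

variable {E : Type*} [NormedAddCommGroup E] [NormedSpace ℝ E] [FiniteDimensional ℝ E]
  {H : Type*} [TopologicalSpace H] {I : ModelWithCorners ℝ E H}
  {M : Type*} [TopologicalSpace M] [ChartedSpace H M] [IsManifold I ∞ M]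

theorem riemManifold_nonneg : 0 ≤ riemManifold I M :=
  Real.sSup_nonneg (Set.forall_mem_range.2 riemMetric_nonneg)

theorem riemManifold_le {c : ℝ} (hc : 0 ≤ c)
    (h : ∀ (g : Metric I M) (t : ℝ), 0 < t → t < (Module.finrank ℝ E).choose 2 →
      (∀ p, 0 < scalAt g p) → RiemTensorPos g t → t ≤ c) : riemManifold I M ≤ c := by
  refine Real.sSup_le (Set.forall_mem_range.2 fun g => ?_) hc
  rw [riemMetric]
  split_ifs with hs
  · refine Real.sSup_le (fun t ht => h g t ht.1 ?_ hs ht.2.2) hc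
    exact (Nat.cast_choose_two ℝ _).symm ▸ ht.2.1
  · exact hc

theorem le_riemManifold {g : Metric I M} {t : ℝ} (ht : 0 < t)
    (ht' : t < (Module.finrank ℝ E).choose 2) (hs : ∀ p, 0 < scalAt g p)
    (hpos : RiemTensorPos g t) : t ≤ riemManifold I M := by
  refine le_csSup_of_le (bddAbove_riemMetric I M) (Set.mem_range_self g) ?_
  rw [riemMetric, if_pos hs, ← Nat.cast_choose_two]
  exact le_csSup ⟨_, fun r hr => hr.2.1.le⟩ ⟨ht, ht', hpos⟩

end Invariant

end RiemInv

end

theorem mainTheorem8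
    {E₁ : Type*} [NormedAddCommGroup E₁] [NormedSpace ℝ E₁] [FiniteDimensional ℝ E₁]
    {H₁ : Type*} [TopologicalSpace H₁] (I₁ : ModelWithCorners ℝ E₁ H₁) [I₁.Boundaryless]
    {E₂ : Type*} [NormedAddCommGroup E₂] [NormedSpace ℝ E₂] [FiniteDimensional ℝ E₂]
    {H₂ : Type*} [TopologicalSpace H₂] (I₂ : ModelWithCorners ℝ E₂ H₂) [I₂.Boundaryless]
    (M₁ : Type*) [TopologicalSpace M₁] [ChartedSpace H₁ M₁] [IsManifold I₁ ∞ M₁]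
    [T2Space M₁] [CompactSpace M₁] [Nonempty M₁]
    (M₂ : Type*) [TopologicalSpace M₂] [ChartedSpace H₂ M₂] [IsManifold I₂ ∞ M₂]
    [T2Space M₂] [CompactSpace M₂] [Nonempty M₂] :
    max (RiemInv.riemManifold I₁ M₁) (RiemInv.riemManifold I₂ M₂) ≤
      RiemInv.riemManifold (I₁.prod I₂) (M₁ × M₂) := by
  open RiemInv in
  have hdim : Module.finrank ℝ (E₁ × E₂) = Module.finrank ℝ E₁ + Module.finrank ℝ E₂ :=
    Module.finrank_prod
  have hprod {g₁ : Metric I₁ M₁} {g₂ : Metric I₂ M₂} {t : ℝ} {n : ℕ} (h : BlocksPos g₁ g₂ t)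
      (ht : 0 < t) (ht_lt : t < n.choose 2) (hn : n ≤ Module.finrank ℝ (E₁ × E₂)) :
      t ≤ riemManifold (I₁.prod I₂) (M₁ × M₂) :=
    le_riemManifold ht (ht_lt.trans_le (mod_cast Nat.choose_le_choose 2 hn))
      h.scalAt_productMetric_pos h.riemTensorPos_productMetric
  refine max_le (riemManifold_le riemManifold_nonneg fun g₁ t ht ht_lt hs hpos => ?_)
    (riemManifold_le riemManifold_nonneg fun g₂ t ht ht_lt hs hpos => ?_)
  · obtain ⟨g₂, hblocks⟩ := exists_blocksPos (I₂ := I₂) (M₂ := M₂) hs hpos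
    exact hprod hblocks ht ht_lt (by lia)
  · obtain ⟨g₁, hblocks⟩ := exists_blocksPos (I₂ := I₁) (M₂ := M₁) hs hpos
    exact hprod hblocks.symm ht ht_lt (by lia)
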